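/- Fix a set $C$ of colours. A coloured graph $G=(V(G),E(G),l_G)$ is a finite simple undirected graph with a labelling $l_G:V(G)\to C$ of its nodes; let $\mathcal N_k(v)$ be the set of nodes at distance at most $k$ from $v$ (so $v\in\mathcal N_k(v)$). For a hop parameter $h\in\mathbb N$, N$^2$-FWL colours all ordered pairs of nodes in rounds. The initial colour $\mathcal C^0(v_1,v_2)$ is the isomorphism type of the pair, i.e. the labels $l_G(v_1),l_G(v_2)$, whether $v_1=v_2$, and whether $v_1v_2\in E(G)$. For $l\ge 1$, $$\mathcal C^{l}(\mathbf v)=\mathrm{HASH}\Bigl(\mathcal C^{l-1}(\mathbf v),\ \{\!\!\{\,(\mathcal C^{l-1}(\mathbf u)\mid \mathbf u\in Q^F_{\mathbf w}(\mathbf v))\ \mid\ \mathbf w\in N^2(\mathbf v)\,\}\!\!\}_2\Bigr),$$ where $\mathrm{HASH}$ is injective (the same for all graphs), $\mathbf v=(v_1,v_2)$, $\mathbf w=(w_1,w_2)$, $$N^2(\mathbf v)=(\mathcal N_1(v_2)\times\mathcal N_1(v_1))\cap(\mathcal N_h(v_1)\cap\mathcal N_h(v_2))^2,$$ $$Q^F_{\mathbf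 w}(\mathbf v)=\bigl((v_1,v_2),(v_1,w_1),(v_1,w_2),(w_1,v_2),(w_2,v_2),(w_1,w_2)\bigr),$$ and $\{\!\!\{\cdot\}\!\!\}_2$ is the hierarchical multiset: the multiset over $w_2$ of the multisets over $w_1$. Two pairs, possibly in different graphs, have the same stable colour if their colours agree in every round. A node colour of $v$ is read off either as the stable colour of the pair $(v,v)$ or as the pooled colour $\{\!\!\{\mathcal C^{l}(v,w)\mid w\in V(G)\}\!\!\}$; two nodes have the same stable pooled colour if their pooled colours agree in every round $l$. N$^2$-FWL (with hop parameter $h$) can count, at node level, a quantity $c(G,v)\in\mathbb N$ attached to every node $v$ of every graph $G$, if for all coloured graphs $G,H$ and nodes $v\in V(G)$, $w\in V(H)$ with $c(G,v)\ne c(H,w)$, the stable node colours of $v$ and $w$ differ, for both ways of reading off a node colour. (The quantities below do not depend on the labels.) **Theorem.** There is an $h_0\in\mathbb N$, independent of the graphs and of $C$, such that for every $h\ge h_0$, N$^2$-FWL with hop parameter $h$ can count at node level: 1. for $k=3,4,5,6$, the number of $k$-cycles (as subgraphs) that contain a given node; 2. for every connected graph $F$ on $4$ vertices, the number of induced subgraphs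 isomorphic to $F$ that contain a given node, and the number of (not necessarily induced) subgraphs isomorphic to $F$ that contain it; and also, for each vertex $r$ of $F$, the numbers of those induced, respectively not necessarily induced, subgraphs in which the given node corresponds to $r$ under some isomorphism from $F$; 3. the number of $4$-paths (paths with $4$ edges, on $5$ distinct nodes) that start at a given node, and the number of $4$-paths that contain it. -/

import Mathlib

namespace N2FWL

universe u

/-- A finite undirected graph on the node set `{0, …, n - 1}` whose nodes carry colours from `C`. -/
structure ColoredGraph (C : Type u) where
  n : ℕ
  graph : SimpleGraph (Fin n)
  label : Fin n → C

section Pairs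

variable {n : ℕ}

/-- `𝒩ₖ(v)`: the nodes within `k` hops of `v`, with `v` itself included. -/
noncomputable def hopNbhd (G : SimpleGraph (Fin n)) (k : ℕ) (v : Fin n) : Finset (Fin n) :=
  open Classical in Finset.univ.filter fun w => G.edist v w ≤ (k : ℕ∞)

/-- `N²(v₁, v₂) = (𝒩₁(v₂) × 𝒩₁(v₁)) ∩ (𝒩ₕ(v₁) ∩ 𝒩ₕ(v₂))²`. -/
noncomputable def nbhd2 (G : SimpleGraph (Fin n)) (h : ℕ) (v : Fin n × Fin n) :
    Finset (Fin n × Fin n) :=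
  (hopNbhd G 1 v.2 ×ˢ hopNbhd G 1 v.1) ∩
    ((hopNbhd G h v.1 ∩ hopNbhd G h v.2) ×ˢ (hopNbhd G h v.1 ∩ hopNbhd G h v.2))

/-- The neighbourhood tuple `Q^F_{(w₁, w₂)}(v₁, v₂)`. -/
def nbhdTuple (v w : Fin n × Fin n) : Fin 6 → Fin n × Fin n :=
  ![(v.1, v.2), (v.1, w.1), (v.1, w.2), (w.1, v.2), (w.2, v.2), (w.1, w.2)]

/-- The hierarchical multiset `{{ f w | w ∈ S }}₂` over a set `S` of pairs: pairs with the same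
second entry are grouped first, and then the groups are collected. -/
def hierMultiset {α : Type u} (S : Finset (Fin n × Fin n)) (f : Fin n × Fin n → α) :
    Multiset (Multiset α) :=
  (S.image Prod.snd).val.map fun b => (S.filter fun w => w.2 = b).val.map f

end Pairs

/-- Colours of pairs after `l` rounds. Round `0` records an isomorphism type: the two labels,
equality and adjacency. The injective hash of later rounds records its argument. -/
def Color (C : Type u) : ℕ → Type u
  | 0 => C × C × Prop × Prop
  | l + 1 => Color C l × Multiset (Multiset (Fin 6 → Color C l))

/-- The N²-FWL colour, with hop parameter `h`, of a pair of nodes after `l` rounds. -/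
noncomputable def color {C : Type u} (h : ℕ) (G : ColoredGraph C) :
    (l : ℕ) → Fin G.n × Fin G.n → Color C l
  | 0, v => (G.label v.1, G.label v.2, v.1 = v.2, G.graph.Adj v.1 v.2)
  | l + 1, v => (color h G l v,
      hierMultiset (nbhd2 G.graph h v) fun w i => color h G l (nbhdTuple v w i))

/-- The pooled colour of the node `v` after `l` rounds: the multiset of the colours of the pairs
`(v, w)`, over all nodes `w`. -/
noncomputable def pooledColor {C : Type u} (h : ℕ) (G : ColoredGraph C) (l : ℕ) (v : Fin G.n) :
    Multiset (Color C l) :=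
  (Finset.univ : Finset (Fin G.n)).val.map fun w => color h G l (v, w)

/-- The pairs `(v, v)` and `(w, w)` have the same stable colour. -/
def SameDiagonalColor {C : Type u} (h : ℕ) (G H : ColoredGraph C) (v : Fin G.n) (w : Fin H.n) :
    Prop :=
  ∀ l, color h G l (v, v) = color h H l (w, w)

/-- The nodes `v` and `w` have the same stable pooled colour. -/
def SamePooledColor {C : Type u} (h : ℕ) (G H : ColoredGraph C) (v : Fin G.n) (w : Fin H.n) :
    Prop :=
  ∀ l, pooledColor h G l v = pooledColor h H l w

/-- A node-level count: a number for every node of every finite graph. -/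
abbrev NodeCount := ∀ {n : ℕ}, SimpleGraph (Fin n) → Fin n → ℕ

/-- N²-FWL with hop parameter `h` can count at node level: two nodes of any two coloured graphs
with different counts get different stable node colours, in either way of reading off a node
colour from the colours of pairs. -/
def CanCount (C : Type u) (h : ℕ) (cnt : NodeCount) : Prop :=
  ∀ (G H : ColoredGraph C) (v : Fin G.n) (w : Fin H.n), cnt G.graph v ≠ cnt H.graph w →
    ¬ SameDiagonalColor h G H v w ∧ ¬ SamePooledColor h G H v w

section Counts

variable {k : ℕ}

/-- The number of subgraphs isomorphic to `F` that contain a given node. -/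
noncomputable def copiesThrough (F : SimpleGraph (Fin k)) : NodeCount := fun G v =>
  Nat.card {S : G.Subgraph // v ∈ S.verts ∧ Nonempty (F ≃g S.coe)}

/-- The number of subgraphs isomorphic to `F` by an isomorphism that sends `r` to a given node. -/
noncomputable def copiesAt (F : SimpleGraph (Fin k)) (r : Fin k) : NodeCount := fun G v =>
  Nat.card {S : G.Subgraph // ∃ φ : F ≃g S.coe, (φ r).1 = v}

/-- The number of induced subgraphs isomorphic to `F` that contain a given node. -/
noncomputable def inducedThrough (F : SimpleGraph (Fin k)) : NodeCount := fun {n} G v =>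
  Nat.card {s : Set (Fin n) // v ∈ s ∧ Nonempty (F ≃g G.induce s)}

/-- The number of induced subgraphs isomorphic to `F` by an isomorphism that sends `r` to a given
node. -/
noncomputable def inducedAt (F : SimpleGraph (Fin k)) (r : Fin k) : NodeCount := fun {n} G v =>
  Nat.card {s : Set (Fin n) // ∃ φ : F ≃g G.induce s, (φ r).1 = v}

end Counts

end N2FWL

namespace N2FWL

universe u

/-! A pooled colour determines the diagonal colour, because round 0 singles out `(v, v)` among the
pairs `(v, x)`. So every count only has to be a function of the stable colour of `(v, v)`.

Once colours are stable, equal colours of `(a, b)` and `(a', b')` match the neighbours `(w₁, w₂)`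
with the neighbours `(u₁, u₂)` so that all six pairs among `a, b, w₁, w₂` keep their colours. Four
nodes are thus controlled at once, and sums over `(w₁, w₂)` of colour-invariant functions agree
(`SameStable.sum_sum`). The central lemma `WalkInv.sum_eq` concerns walks `x₀x₁x₂x₃`: if a weight
depends only on the colours of the pairs in the walk, then its sum over the walks with `x_r = v`
depends only on the colour of `(v, v)`. For `r = 1` the sum is organised around the edge `x₁x₂`, for
`r = 0` around the pair `(x₀, x₂)`; reversal gives the rest.

Subgraphs are counted as injective maps divided by automorphisms. A graph on four vertices with a
Hamiltonian path is such a weight directly. Larger patterns, and the claw, are walks with the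
remaining nodes summed out; by inclusion and exclusion these inner sums are expressed through
adjacency, degrees, common neighbours and paths with three edges, all determined by pair colours. -/

/-- The pairs `p` and `q` have the same stable colour. -/
def SameStable {C : Type u} (h : ℕ) (G H : ColoredGraph C) (p : Fin G.n × Fin G.n)
    (q : Fin H.n × Fin H.n) : Prop :=
  ∀ l, color h G l p = color h H l q

/-! ### Stable colours and the matching of neighbourhoods -/

section Stable

variable {C : Type u} {h : ℕ} {G H : ColoredGraph C}

theorem SameStable.symm {p : Fin G.n × Fin G.n} {q : Fin H.n × Fin H.n}
    (hs : SameStable h G H p q) : SameStable h H G q p :=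
  fun l => (hs l).symm

theorem color_eq_of_le {p : Fin G.n × Fin G.n} {q : Fin H.n × Fin H.n} {l m : ℕ} (hlm : l ≤ m)
    (hc : color h G m p = color h H m q) : color h G l p = color h H l q := by
  induction hlm with
  | refl => exact hc
  | step _ ih => exact ih (congrArg Prod.fst hc)

theorem SameStable.eq_iff {a b : Fin G.n} {a' b' : Fin H.n}
    (hs : SameStable h G H (a, b) (a', b')) : a = b ↔ a' = b' :=
  iff_of_eq (congrArg (fun c : C × C × Prop × Prop => c.2.2.1) (hs 0))

theorem SameStable.adj_iff {a b : Fin G.n} {a' b' : Fin H.n}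
    (hs : SameStable h G H (a, b) (a', b')) : G.graph.Adj a b ↔ H.graph.Adj a' b' :=
  iff_of_eq (congrArg (fun c : C × C × Prop × Prop => c.2.2.2) (hs 0))

/-- After finitely many rounds the colours of the pairs of two finite graphs are stable. -/
theorem exists_stable_round (h : ℕ) (G H : ColoredGraph C) :
    ∃ l, ∀ p q, color h G l p = color h H l q → SameStable h G H p q := by
  have hex : ∀ x : (Fin G.n × Fin G.n) × (Fin H.n × Fin H.n),
      ∃ l, color h G l x.1 = color h H l x.2 → SameStable h G H x.1 x.2 := by
    intro x
    by_cases hx : SameStable h G H x.1 x.2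
    · exact ⟨0, fun _ => hx⟩
    · simp only [SameStable, not_forall] at hx
      obtain ⟨l, hl⟩ := hx
      exact ⟨l, fun hc => absurd hc hl⟩
  choose L hL using hex
  exact ⟨Finset.univ.sup L, fun p q hc =>
    hL (p, q) (color_eq_of_le (Finset.le_sup (Finset.mem_univ (p, q))) hc)⟩

/-- Equality of the images is a matching of the two multisets, and `f` and `g` agree along it. -/
theorem sum_eq_of_map_eq {ι κ α : Type*} {S : Multiset ι} {T : Multiset κ} {φ : ι → α} {ψ : κ → α}
    (he : S.map φ = T.map ψ) {f : ι → ℚ} {g : κ → ℚ}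
    (hfg : ∀ w ∈ S, ∀ u ∈ T, φ w = ψ u → f w = g u) : (S.map f).sum = (T.map g).sum := by
  have h1 : Multiset.Rel (fun a b => φ a = ψ b) S T := by
    rw [← Multiset.rel_eq, Multiset.rel_map] at he
    exact he
  have h2 := h1.mono hfg
  have h3 : Multiset.Rel Eq (S.map f) (T.map g) := Multiset.rel_map.2 h2
  rw [Multiset.rel_eq] at h3
  rw [h3]

/-- The matching is applied twice, to the groups and then inside matched groups. After that the
grouping is forgotten: only the flat sum is used later. -/
theorem sum_eq_of_hierMultiset_eq {n m : ℕ} {α : Type u} {S : Finset (Fin n × Fin n)}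
    {T : Finset (Fin m × Fin m)} {φ : Fin n × Fin n → α} {ψ : Fin m × Fin m → α}
    (he : hierMultiset S φ = hierMultiset T ψ) {f : Fin n × Fin n → ℚ} {g : Fin m × Fin m → ℚ}
    (hfg : ∀ w ∈ S, ∀ u ∈ T, φ w = ψ u → f w = g u) : ∑ w ∈ S, f w = ∑ u ∈ T, g u := by
  rw [← Finset.sum_fiberwise_of_maps_to (fun w hw => Finset.mem_image_of_mem Prod.snd hw) f,
    ← Finset.sum_fiberwise_of_maps_to (fun w hw => Finset.mem_image_of_mem Prod.snd hw) g]
  refine sum_eq_of_map_eq he fun b _ c _ hbc => ?_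
  refine sum_eq_of_map_eq hbc fun w hw u hu => ?_
  exact hfg w (Finset.mem_of_mem_filter w hw) u (Finset.mem_of_mem_filter u hu)

/-- Pairs of the same stable colour have neighbourhoods that match up to stable colours. -/
theorem SameStable.sum_nbhd2 {p : Fin G.n × Fin G.n} {q : Fin H.n × Fin H.n}
    (hs : SameStable h G H p q) {f : Fin G.n × Fin G.n → ℚ} {g : Fin H.n × Fin H.n → ℚ}
    (hfg : ∀ w ∈ nbhd2 G.graph h p, ∀ u ∈ nbhd2 H.graph h q,
      (∀ i, SameStable h G H (nbhdTuple p w i) (nbhdTuple q u i)) → f w = g u) :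
    ∑ w ∈ nbhd2 G.graph h p, f w = ∑ u ∈ nbhd2 H.graph h q, g u := by
  obtain ⟨l, hl⟩ := exists_stable_round h G H
  exact sum_eq_of_hierMultiset_eq (congrArg Prod.snd (hs (l + 1))) fun w hw u hu hwu =>
    hfg w hw u hu fun i => hl _ _ (congrFun hwu i)

-- Otherwise the indicator of "coloured like `w`" would have a positive sum on one side, thanks to
-- `w` itself, and sum zero on the other.
open Classical in
theorem SameStable.exists_nbhd2 {p : Fin G.n × Fin G.n} {q : Fin H.n × Fin H.n}
    (hs : SameStable h G H p q) {w : Fin G.n × Fin G.n} (hw : w ∈ nbhd2 G.graph h p) :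
    ∃ u ∈ nbhd2 H.graph h q, ∀ i, SameStable h G H (nbhdTuple p w i) (nbhdTuple q u i) := by
  by_contra hne
  push Not at hne
  have hsum := hs.sum_nbhd2
    (f := fun x => if ∀ i, SameStable h G G (nbhdTuple p w i) (nbhdTuple p x i) then 1 else 0)
    (g := fun u => if ∀ i, SameStable h G H (nbhdTuple p w i) (nbhdTuple q u i) then 1 else 0) (by
      intro x _ u _ hxu
      refine if_congr (forall_congr' fun i => forall_congr' fun l => ?_) rfl rfl
      rw [hxu i l])
  have hzero : ∑ u ∈ nbhd2 H.graph h q,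
      (if ∀ i, SameStable h G H (nbhdTuple p w i) (nbhdTuple q u i) then (1 : ℚ) else 0) = 0 := by
    refine Finset.sum_eq_zero fun u hu => if_neg fun hall => ?_
    obtain ⟨i, hi⟩ := hne u hu
    exact hi (hall i)
  rw [hzero, Finset.sum_eq_zero_iff_of_nonneg (fun x _ => by positivity)] at hsum
  have := hsum w hw
  exact one_ne_zero ((if_pos fun i l => rfl).symm.trans this)

theorem mem_nbhd2 (hh : 1 ≤ h) {a b w₁ w₂ : Fin G.n} (h1 : G.graph.edist b w₁ ≤ 1)
    (h2 : G.graph.edist a w₂ ≤ 1) (h3 : G.graph.edist a w₁ ≤ h) (h4 : G.graph.edist b w₂ ≤ h) :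
    (w₁, w₂) ∈ nbhd2 G.graph h (a, b) := by
  have hh' : (1 : ℕ∞) ≤ h := by exact_mod_cast hh
  simp [nbhd2, hopNbhd, h1, h2, h3, h4, h1.trans hh', h2.trans hh']

/-- The colour of a pair determines that of the swapped pair. -/
theorem SameStable.swap (hh : 1 ≤ h) {a b : Fin G.n} {a' b' : Fin H.n}
    (hs : SameStable h G H (a, b) (a', b')) (hab : G.graph.edist a b ≤ h) :
    SameStable h G H (b, a) (b', a') := by
  -- The neighbour `(b, a)` makes the entries 2 and 3 of the tuple diagonal, which forces its
  -- partner to be `(b', a')`; entry 5 is then the swapped pair.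
  obtain ⟨⟨u₁, u₂⟩, -, hu⟩ := hs.exists_nbhd2 (w := (b, a))
    (mem_nbhd2 hh (by simp) (by simp) hab (by rwa [SimpleGraph.edist_comm]))
  have e1 : a' = u₂ := (hu 2).eq_iff.1 rfl
  have e2 : u₁ = b' := (hu 3).eq_iff.1 rfl
  subst e1 e2
  exact hu 5

/-- The five colours in `hfg` together with `hs` cover all pairs among the four nodes. The support
conditions let the sums run over all nodes. -/
theorem SameStable.sum_sum {a b : Fin G.n} {a' b' : Fin H.n}
    (hs : SameStable h G H (a, b) (a', b')) {f : Fin G.n → Fin G.n → ℚ} {g : Fin H.n → Fin H.n → ℚ}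
    (hf : ∀ w₁ w₂, f w₁ w₂ ≠ 0 → (w₁, w₂) ∈ nbhd2 G.graph h (a, b))
    (hg : ∀ w₁ w₂, g w₁ w₂ ≠ 0 → (w₁, w₂) ∈ nbhd2 H.graph h (a', b'))
    (hfg : ∀ w₁ w₂ u₁ u₂, SameStable h G H (a, w₁) (a', u₁) → SameStable h G H (a, w₂) (a', u₂) →
      SameStable h G H (w₁, b) (u₁, b') → SameStable h G H (w₂, b) (u₂, b') →
      SameStable h G H (w₁, w₂) (u₁, u₂) → f w₁ w₂ = g u₁ u₂) :
    ∑ w₁, ∑ w₂, f w₁ w₂ = ∑ u₁, ∑ u₂, g u₁ u₂ := by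
  rw [← Fintype.sum_prod_type', ← Fintype.sum_prod_type',
    ← Finset.sum_subset (Finset.subset_univ (nbhd2 G.graph h (a, b))),
    ← Finset.sum_subset (Finset.subset_univ (nbhd2 H.graph h (a', b')))]
  · exact hs.sum_nbhd2 fun w _ u _ hwu => hfg _ _ _ _ (hwu 1) (hwu 2) (hwu 3) (hwu 4) (hwu 5)
  · exact fun w _ hw => not_not.1 fun h0 => hw (hg _ _ h0)
  · exact fun w _ hw => not_not.1 fun h0 => hw (hf _ _ h0)

/-- A sum over a single node, obtained by pinning `w₂ = a`; the bound on the distance from `b` to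
`a` keeps this choice inside the neighbourhood. -/
theorem SameStable.sum_right (hh : 1 ≤ h) {a b : Fin G.n} {a' b' : Fin H.n}
    (hs : SameStable h G H (a, b) (a', b')) {f : Fin G.n → ℚ} {g : Fin H.n → ℚ}
    (hf : ∀ c, f c ≠ 0 → G.graph.edist b c ≤ 1 ∧ G.graph.edist a c ≤ h ∧ G.graph.edist b a ≤ h)
    (hg : ∀ c, g c ≠ 0 → H.graph.edist b' c ≤ 1 ∧ H.graph.edist a' c ≤ h ∧ H.graph.edist b' a' ≤ h)
    (hfg : ∀ c c', SameStable h G H (a, c) (a', c') → SameStable h G H (c, b) (c', b') →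
      f c = g c') :
    ∑ c, f c = ∑ c, g c := by
  have key := hs.sum_sum (f := fun c x => if a = x then f c else 0)
    (g := fun c x => if a' = x then g c else 0)
    (by
      intro c x hx
      obtain ⟨rfl, h0⟩ := ite_ne_right_iff.1 hx
      obtain ⟨h1, h2, h3⟩ := hf c h0
      exact mem_nbhd2 hh h1 (by simp) h2 h3)
    (by
      intro c x hx
      obtain ⟨rfl, h0⟩ := ite_ne_right_iff.1 hx
      obtain ⟨h1, h2, h3⟩ := hg c h0
      exact mem_nbhd2 hh h1 (by simp) h2 h3)
    (fun c x c' x' h1 h2 h3 _ _ => if_congr h2.eq_iff (hfg c c' h1 h3) rfl)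
  simpa using key

/-- The colour of `(v, v)` occurs in the pool of `w` as that of some `(w, x)`, and round 0 records
equality, so `x = w`. -/
theorem SamePooledColor.sameDiagonalColor {v : Fin G.n} {w : Fin H.n}
    (hp : SamePooledColor h G H v w) : SameDiagonalColor h G H v w := by
  intro l
  have hm : color h G l (v, v) ∈ pooledColor h H l w := by
    rw [← hp l]
    exact Multiset.mem_map_of_mem _ (Finset.mem_univ v)
  obtain ⟨x, -, hx⟩ := Multiset.mem_map.1 hm
  have h0 : color h H 0 (w, x) = color h G 0 (v, v) := color_eq_of_le (Nat.zero_le l) hx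
  have hwx : w = x :=
    (iff_of_eq (congrArg (fun c : C × C × Prop × Prop => c.2.2.1) h0)).2 rfl
  subst hwx
  exact hx.symm

end Stable

/-- Nodes with the same stable diagonal colour have the same count. -/
def NodeDet (C : Type u) (h : ℕ) (cnt : NodeCount) : Prop :=
  ∀ (G H : ColoredGraph C) (v : Fin G.n) (w : Fin H.n), SameStable h G H (v, v) (w, w) →
    cnt G.graph v = cnt H.graph w

theorem NodeDet.canCount {C : Type u} {h : ℕ} {cnt : NodeCount} (hd : NodeDet C h cnt) :
    CanCount C h cnt :=
  fun G H v w hne => ⟨fun hs => hne (hd G H v w hs),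
    fun hp => hne (hd G H v w hp.sameDiagonalColor)⟩

/-! ### Sums over walks on four nodes -/

section Tuples

variable {C : Type u} {h : ℕ}

/-- A rational number attached to every pair of nodes that depends on the stable colour only. -/
def PairInv (h : ℕ) (f : (G : ColoredGraph C) → Fin G.n → Fin G.n → ℚ) : Prop :=
  ∀ ⦃G H : ColoredGraph C⦄ ⦃a b : Fin G.n⦄ ⦃a' b' : Fin H.n⦄,
    SameStable h G H (a, b) (a', b') → f G a b = f H a' b'

/-- Corresponding pairs of distinct entries of two tuples have the same stable colours. -/
def TupleStable (h : ℕ) (G H : ColoredGraph C) (x : Fin 4 → Fin G.n) (y : Fin 4 → Fin H.n) : Prop :=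
  ∀ i j, i ≠ j → SameStable h G H (x i, x j) (y i, y j)

/-- The entries of a tuple form a walk. -/
def IsWalk {n : ℕ} (G : SimpleGraph (Fin n)) (x : Fin 4 → Fin n) : Prop :=
  G.Adj (x 0) (x 1) ∧ G.Adj (x 1) (x 2) ∧ G.Adj (x 2) (x 3)

/-- A rational number attached to every walk on four nodes that depends on the stable colours of
its pairs only, and vanishes on other tuples. -/
structure WalkInv (h : ℕ) (W : (G : ColoredGraph C) → (Fin 4 → Fin G.n) → ℚ) : Prop where
  inv : ∀ ⦃G H : ColoredGraph C⦄ ⦃x : Fin 4 → Fin G.n⦄ ⦃y : Fin 4 → Fin H.n⦄, IsWalk G.graph x →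
    IsWalk H.graph y → TupleStable h G H x y → W G x = W H y
  supp : ∀ ⦃G : ColoredGraph C⦄ ⦃x : Fin 4 → Fin G.n⦄, W G x ≠ 0 → IsWalk G.graph x

theorem edist_le_one {n : ℕ} {G : SimpleGraph (Fin n)} {a b : Fin n} (h1 : G.Adj a b) :
    G.edist a b ≤ 1 :=
  (SimpleGraph.edist_eq_one_iff_adj.2 h1).le

theorem edist_le_two {n : ℕ} {G : SimpleGraph (Fin n)} {a b c : Fin n} (h1 : G.Adj a b)
    (h2 : G.Adj b c) : G.edist a c ≤ 2 :=
  SimpleGraph.edist_le (.cons h1 (.cons h2 .nil))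

theorem edist_le_three {n : ℕ} {G : SimpleGraph (Fin n)} {a b c d : Fin n} (h1 : G.Adj a b)
    (h2 : G.Adj b c) (h3 : G.Adj c d) : G.edist a d ≤ 3 :=
  SimpleGraph.edist_le (.cons h1 (.cons h2 (.cons h3 .nil)))

theorem IsWalk.edist_le {n : ℕ} {G : SimpleGraph (Fin n)} {x : Fin 4 → Fin n} (hx : IsWalk G x)
    (i j : Fin 4) : G.edist (x i) (x j) ≤ 3 := by
  obtain ⟨h1, h2, h3⟩ := hx
  have e1 : (1 : ℕ∞) ≤ 3 := by norm_num
  have e2 : (2 : ℕ∞) ≤ 3 := by norm_num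
  have key : ∀ i j : Fin 4, i < j → G.edist (x i) (x j) ≤ 3 := by
    intro i j hij
    fin_cases i <;> fin_cases j <;> first
      | exact absurd hij (by decide)
      | exact (edist_le_one h1).trans e1
      | exact (edist_le_one h2).trans e1
      | exact (edist_le_one h3).trans e1
      | exact (edist_le_two h1 h2).trans e2
      | exact (edist_le_two h2 h3).trans e2
      | exact edist_le_three h1 h2 h3
  rcases lt_trichotomy i j with hij | rfl | hij
  · exact key i j hij
  · simp
  · rw [SimpleGraph.edist_comm]
    exact key j i hij

theorem TupleStable.adj_iff {G H : ColoredGraph C} {x : Fin 4 → Fin G.n} {y : Fin 4 → Fin H.n}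
    (hs : TupleStable h G H x y) (i j : Fin 4) :
    G.graph.Adj (x i) (x j) ↔ H.graph.Adj (y i) (y j) := by
  by_cases hij : i = j
  · simp [hij]
  · exact (hs i j hij).adj_iff

theorem TupleStable.eq_iff {G H : ColoredGraph C} {x : Fin 4 → Fin G.n} {y : Fin 4 → Fin H.n}
    (hs : TupleStable h G H x y) (i j : Fin 4) : x i = x j ↔ y i = y j := by
  by_cases hij : i = j
  · simp [hij]
  · exact (hs i j hij).eq_iff

/-- Six pairs, one for each pair of positions, suffice for two walks to be matched. -/
theorem WalkInv.eq_of_pairs {W : (G : ColoredGraph C) → (Fin 4 → Fin G.n) → ℚ} (hW : WalkInv h W)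
    (hh : 3 ≤ h) {G H : ColoredGraph C} {x : Fin 4 → Fin G.n} {y : Fin 4 → Fin H.n}
    (hs : ∀ i j : Fin 4, i < j → SameStable h G H (x i, x j) (y i, y j) ∨
      SameStable h G H (x j, x i) (y j, y i)) : W G x = W H y := by
  have hadj : ∀ i j : Fin 4, i < j → (G.graph.Adj (x i) (x j) ↔ H.graph.Adj (y i) (y j)) := by
    intro i j hij
    rcases hs i j hij with h1 | h1
    · exact h1.adj_iff
    · rw [SimpleGraph.adj_comm, h1.adj_iff, SimpleGraph.adj_comm]
  have hwalk : IsWalk G.graph x ↔ IsWalk H.graph y := by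
    simp only [IsWalk, hadj 0 1 (by decide), hadj 1 2 (by decide), hadj 2 3 (by decide)]
  by_cases hx : IsWalk G.graph x
  · have hd : ∀ i j, G.graph.edist (x i) (x j) ≤ h :=
      fun i j => (hx.edist_le i j).trans (by exact_mod_cast hh)
    refine hW.inv hx (hwalk.1 hx) fun i j hij => ?_
    rcases lt_or_gt_of_ne hij with hlt | hlt
    · exact (hs i j hlt).elim id fun h1 => h1.swap (by omega) (hd j i)
    · exact (hs j i hlt).elim (fun h1 => h1.swap (by omega) (hd j i)) id
  · rw [not_not.1 fun h0 => hx (hW.supp h0), not_not.1 fun h0 => hx (hwalk.2 (hW.supp h0))]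

theorem WalkInv.reverse {W : (G : ColoredGraph C) → (Fin 4 → Fin G.n) → ℚ} (hW : WalkInv h W) :
    WalkInv h fun G x => W G (x ∘ Fin.rev) where
  inv G H x y hx hy hs :=
    hW.inv ⟨hx.2.2.symm, hx.2.1.symm, hx.1.symm⟩ ⟨hy.2.2.symm, hy.2.1.symm, hy.1.symm⟩
      fun i j hij => hs _ _ (Fin.rev_injective.ne hij)
  supp G x h0 := by
    obtain ⟨h1, h2, h3⟩ := hW.supp h0
    exact ⟨h3.symm, h2.symm, h1.symm⟩

theorem sum_fin_succ {α : Type*} [Fintype α] {k : ℕ} (F : (Fin (k + 1) → α) → ℚ) :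
    ∑ x, F x = ∑ a, ∑ x : Fin k → α, F (Matrix.vecCons a x) := by
  rw [← Fintype.sum_prod_type']
  exact (Fintype.sum_equiv (Fin.consEquiv fun _ => α) _ _ fun x => rfl).symm

theorem sum_fin_four {α : Type*} [Fintype α] (F : (Fin 4 → α) → ℚ) :
    ∑ x, F x = ∑ a, ∑ b, ∑ c, ∑ d, F ![a, b, c, d] := by
  simp only [sum_fin_succ, Fintype.sum_unique]
  rfl

/-- The sum of a function of pairs over the second entry. -/
theorem PairInv.sum_adj (hh : 1 ≤ h) {g : (G : ColoredGraph C) → Fin G.n → Fin G.n → ℚ}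
    (hg : PairInv h g) (hs : ∀ ⦃G : ColoredGraph C⦄ ⦃a b⦄, g G a b ≠ 0 → G.graph.Adj a b)
    {G H : ColoredGraph C} {v : Fin G.n} {w : Fin H.n} (hvw : SameStable h G H (v, v) (w, w)) :
    ∑ b, g G v b = ∑ b, g H w b := by
  have hh' : (1 : ℕ∞) ≤ h := by exact_mod_cast hh
  refine hvw.sum_right hh (fun c hc => ?_) (fun c hc => ?_) fun c c' h1 _ => hg h1
  · exact ⟨edist_le_one (hs hc), (edist_le_one (hs hc)).trans hh', by simp⟩
  · exact ⟨edist_le_one (hs hc), (edist_le_one (hs hc)).trans hh', by simp⟩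

/-! ### Quantities determined by the colour of a pair -/

open Classical in
/-- The number of common neighbours. -/
noncomputable def commonNbrs (G : ColoredGraph C) (a b : Fin G.n) : ℚ :=
  ∑ c, if G.graph.Adj a c ∧ G.graph.Adj c b then 1 else 0

open Classical in
/-- The degree of `b` if `a` is adjacent to `b`, and zero otherwise. -/
noncomputable def nbrDegree (G : ColoredGraph C) (a b : Fin G.n) : ℚ :=
  ∑ c, if G.graph.Adj a b ∧ G.graph.Adj b c then 1 else 0

open Classical in
/-- The number of paths with three edges between two nodes. -/
noncomputable def threePaths (G : ColoredGraph C) (a b : Fin G.n) : ℚ :=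
  ∑ c, ∑ d, if G.graph.Adj a d ∧ G.graph.Adj d c ∧ G.graph.Adj c b ∧ d ≠ b ∧ a ≠ c then 1 else 0

open Classical in
theorem pairInv_commonNbrs (hh : 3 ≤ h) : PairInv h (commonNbrs (C := C)) := by
  have hh1 : (1 : ℕ∞) ≤ h := by exact_mod_cast (by omega : 1 ≤ h)
  have hh2 : (2 : ℕ∞) ≤ h := by exact_mod_cast (by omega : 2 ≤ h)
  intro G H a b a' b' hs
  refine hs.sum_right (by omega) (fun c hc => ?_) (fun c hc => ?_) fun c c' h1 h2 =>
    if_congr (and_congr h1.adj_iff h2.adj_iff) rfl rfl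
  · obtain ⟨⟨h1, h2⟩, -⟩ := ite_ne_right_iff.1 hc
    exact ⟨edist_le_one h2.symm, (edist_le_one h1).trans hh1,
      (edist_le_two h2.symm h1.symm).trans hh2⟩
  · obtain ⟨⟨h1, h2⟩, -⟩ := ite_ne_right_iff.1 hc
    exact ⟨edist_le_one h2.symm, (edist_le_one h1).trans hh1,
      (edist_le_two h2.symm h1.symm).trans hh2⟩

-- Adjacency of `a` and `b` keeps every neighbour of `b` within two hops of `a`, hence inside the
-- neighbourhood of the pair.
open Classical in
theorem pairInv_nbrDegree (hh : 3 ≤ h) : PairInv h (nbrDegree (C := C)) := by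
  have hh1 : (1 : ℕ∞) ≤ h := by exact_mod_cast (by omega : 1 ≤ h)
  have hh2 : (2 : ℕ∞) ≤ h := by exact_mod_cast (by omega : 2 ≤ h)
  intro G H a b a' b' hs
  refine hs.sum_right (by omega) (fun c hc => ?_) (fun c hc => ?_) fun c c' _ h2 => ?_
  · obtain ⟨⟨h1, h2⟩, -⟩ := ite_ne_right_iff.1 hc
    exact ⟨edist_le_one h2, (edist_le_two h1 h2).trans hh2, (edist_le_one h1.symm).trans hh1⟩
  · obtain ⟨⟨h1, h2⟩, -⟩ := ite_ne_right_iff.1 hc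
    exact ⟨edist_le_one h2, (edist_le_two h1 h2).trans hh2, (edist_le_one h1.symm).trans hh1⟩
  · refine if_congr (and_congr hs.adj_iff ?_) rfl rfl
    rw [SimpleGraph.adj_comm, h2.adj_iff, SimpleGraph.adj_comm]

-- The inner nodes are `w₁`, next to `b`, and `w₂`, next to `a`; the colour of `(w₁, w₂)` tells
-- whether they are adjacent.
open Classical in
theorem pairInv_threePaths (hh : 3 ≤ h) : PairInv h (threePaths (C := C)) := by
  have hh2 : (2 : ℕ∞) ≤ h := by exact_mod_cast (by omega : 2 ≤ h)
  intro G H a b a' b' hs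
  refine hs.sum_sum (fun c d hc => ?_) (fun c d hc => ?_) fun w₁ w₂ u₁ u₂ h1 h2 h3 h4 h5 => ?_
  · obtain ⟨⟨h1, h2, h3, -⟩, -⟩ := ite_ne_right_iff.1 hc
    exact mem_nbhd2 (by omega) (edist_le_one h3.symm) (edist_le_one h1)
      ((edist_le_two h1 h2).trans hh2) ((edist_le_two h3.symm h2.symm).trans hh2)
  · obtain ⟨⟨h1, h2, h3, -⟩, -⟩ := ite_ne_right_iff.1 hc
    exact mem_nbhd2 (by omega) (edist_le_one h3.symm) (edist_le_one h1)
      ((edist_le_two h1 h2).trans hh2) ((edist_le_two h3.symm h2.symm).trans hh2)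
  · refine if_congr ?_ rfl rfl
    rw [h2.adj_iff, SimpleGraph.adj_comm _ w₂, h5.adj_iff, SimpleGraph.adj_comm _ u₁, h3.adj_iff,
      Ne, Ne, h4.eq_iff, h1.eq_iff]

theorem commonNbrs_ne_zero {G : ColoredGraph C} {a b c : Fin G.n} (h1 : G.graph.Adj a b)
    (h2 : G.graph.Adj b c) : commonNbrs G a c ≠ 0 := by
  classical
  refine (Finset.sum_pos' (fun x _ => by positivity) ⟨b, Finset.mem_univ b, ?_⟩).ne'
  rw [if_pos ⟨h1, h2⟩]
  exact one_pos

-- The neighbourhood of `(v, v)` does not reach two steps away. The sum therefore passes through a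
-- middle node `b`, each term `g G v c` being divided by the number of common neighbours of `v` and
-- `c`, so that the shares of all `b` add up to the full term. This division is why the sums are
-- rational.
open Classical in
theorem PairInv.sum_two_steps (hh : 3 ≤ h) {g : (G : ColoredGraph C) → Fin G.n → Fin G.n → ℚ}
    (hg : PairInv h g)
    (hs : ∀ ⦃G : ColoredGraph C⦄ ⦃a c⦄, g G a c ≠ 0 → ∃ b, G.graph.Adj a b ∧ G.graph.Adj b c)
    {G H : ColoredGraph C} {v : Fin G.n} {w : Fin H.n} (hvw : SameStable h G H (v, v) (w, w)) :
    ∑ c, g G v c = ∑ c, g H w c := by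
  have hh1 : (1 : ℕ∞) ≤ h := by exact_mod_cast (by omega : 1 ≤ h)
  have hh2 : (2 : ℕ∞) ≤ h := by exact_mod_cast (by omega : 2 ≤ h)
  have hq : PairInv h fun G a b => ∑ c, if G.graph.Adj a b ∧ G.graph.Adj b c then
      g G a c / commonNbrs G a c else 0 := by
    intro G H a b a' b' hs
    refine hs.sum_right (by omega) (fun c hc => ?_) (fun c hc => ?_) fun c c' h1 h2 => ?_
    · obtain ⟨⟨h1, h2⟩, -⟩ := ite_ne_right_iff.1 hc
      exact ⟨edist_le_one h2, (edist_le_two h1 h2).trans hh2, (edist_le_one h1.symm).trans hh1⟩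
    · obtain ⟨⟨h1, h2⟩, -⟩ := ite_ne_right_iff.1 hc
      exact ⟨edist_le_one h2, (edist_le_two h1 h2).trans hh2, (edist_le_one h1.symm).trans hh1⟩
    · rw [hg h1, pairInv_commonNbrs hh h1]
      refine if_congr (and_congr hs.adj_iff ?_) rfl rfl
      rw [SimpleGraph.adj_comm, h2.adj_iff, SimpleGraph.adj_comm]
  have hsum : ∀ (G : ColoredGraph C) (a : Fin G.n), ∑ c, g G a c =
      ∑ b, ∑ c, if G.graph.Adj a b ∧ G.graph.Adj b c then g G a c / commonNbrs G a c else 0 := by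
    intro G a
    rw [Finset.sum_comm]
    refine Finset.sum_congr rfl fun c _ => ?_
    have : ∀ b, (if G.graph.Adj a b ∧ G.graph.Adj b c then g G a c / commonNbrs G a c else 0) =
        (if G.graph.Adj a b ∧ G.graph.Adj b c then 1 else 0) * (g G a c / commonNbrs G a c) := by
      intro b
      split_ifs <;> simp
    rw [Finset.sum_congr rfl fun b _ => this b, ← Finset.sum_mul]
    change _ = commonNbrs G a c * _
    by_cases h0 : g G a c = 0
    · simp [h0]
    · obtain ⟨b, h1, h2⟩ := hs h0
      rw [mul_div_cancel₀ _ (commonNbrs_ne_zero h1 h2)]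
  rw [hsum, hsum]
  refine hq.sum_adj (by omega) (fun G a b h0 => ?_) hvw
  obtain ⟨c, -, hc⟩ := Finset.exists_ne_zero_of_sum_ne_zero h0
  exact (ite_ne_right_iff.1 hc).1.1

/-- The pair is the middle edge `(x₁, x₂)`, with `w₁ = x₃` and `w₂ = x₀`; what remains is a sum over
the neighbours `x₂` of `v`. -/
theorem WalkInv.sum_one (hh : 3 ≤ h) {W : (G : ColoredGraph C) → (Fin 4 → Fin G.n) → ℚ}
    (hW : WalkInv h W) {G H : ColoredGraph C} {v : Fin G.n} {w : Fin H.n}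
    (hvw : SameStable h G H (v, v) (w, w)) :
    ∑ c, ∑ d, ∑ a, W G ![a, v, c, d] = ∑ c, ∑ d, ∑ a, W H ![a, w, c, d] := by
  have hh2 : (2 : ℕ∞) ≤ h := by exact_mod_cast (by omega : 2 ≤ h)
  have hg : PairInv h fun G b c => ∑ d, ∑ a, W G ![a, b, c, d] := by
    intro G H b c b' c' hs
    refine hs.sum_sum (fun d a h0 => ?_) (fun d a h0 => ?_) fun w₁ w₂ u₁ u₂ h1 h2 h3 h4 h5 => ?_
    · obtain ⟨h1, h2, h3⟩ : G.graph.Adj a b ∧ G.graph.Adj b c ∧ G.graph.Adj c d := hW.supp h0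
      exact mem_nbhd2 (by omega) (edist_le_one h3) (edist_le_one h1.symm)
        ((edist_le_two h2 h3).trans hh2) ((edist_le_two h2.symm h1.symm).trans hh2)
    · obtain ⟨h1, h2, h3⟩ : H.graph.Adj a b' ∧ H.graph.Adj b' c' ∧ H.graph.Adj c' d := hW.supp h0
      exact mem_nbhd2 (by omega) (edist_le_one h3) (edist_le_one h1.symm)
        ((edist_le_two h2 h3).trans hh2) ((edist_le_two h2.symm h1.symm).trans hh2)
    · refine hW.eq_of_pairs hh fun i j hij => ?_
      fin_cases i <;> fin_cases j <;> first
        | exact absurd hij (by decide)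
        | exact .inl h1
        | exact .inl h2
        | exact .inl h3
        | exact .inl h4
        | exact .inl h5
        | exact .inl hs
        | exact .inr h1
        | exact .inr h2
        | exact .inr h3
        | exact .inr h4
        | exact .inr h5
  refine hg.sum_adj (by omega) (fun G b c h0 => ?_) hvw
  obtain ⟨d, -, hd⟩ := Finset.exists_ne_zero_of_sum_ne_zero h0
  obtain ⟨a, -, ha⟩ := Finset.exists_ne_zero_of_sum_ne_zero hd
  exact (hW.supp ha).2.1

/-- The pair is `(x₀, x₂)`, with `w₁ = x₃` and `w₂ = x₁`; what remains is a sum over nodes `x₂` two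
steps from `v`. -/
theorem WalkInv.sum_zero (hh : 3 ≤ h) {W : (G : ColoredGraph C) → (Fin 4 → Fin G.n) → ℚ}
    (hW : WalkInv h W) {G H : ColoredGraph C} {v : Fin G.n} {w : Fin H.n}
    (hvw : SameStable h G H (v, v) (w, w)) :
    ∑ c, ∑ d, ∑ b, W G ![v, b, c, d] = ∑ c, ∑ d, ∑ b, W H ![w, b, c, d] := by
  have hh1 : (1 : ℕ∞) ≤ h := by exact_mod_cast (by omega : 1 ≤ h)
  have hh3 : (3 : ℕ∞) ≤ h := by exact_mod_cast hh
  have hg : PairInv h fun G a c => ∑ d, ∑ b, W G ![a, b, c, d] := by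
    intro G H a c a' c' hs
    refine hs.sum_sum (fun d b h0 => ?_) (fun d b h0 => ?_) fun w₁ w₂ u₁ u₂ h1 h2 h3 h4 h5 => ?_
    · obtain ⟨h1, h2, h3⟩ : G.graph.Adj a b ∧ G.graph.Adj b c ∧ G.graph.Adj c d := hW.supp h0
      exact mem_nbhd2 (by omega) (edist_le_one h3) (edist_le_one h1)
        ((edist_le_three h1 h2 h3).trans hh3) ((edist_le_one h2.symm).trans hh1)
    · obtain ⟨h1, h2, h3⟩ : H.graph.Adj a' b ∧ H.graph.Adj b c' ∧ H.graph.Adj c' d := hW.supp h0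
      exact mem_nbhd2 (by omega) (edist_le_one h3) (edist_le_one h1)
        ((edist_le_three h1 h2 h3).trans hh3) ((edist_le_one h2.symm).trans hh1)
    · refine hW.eq_of_pairs hh fun i j hij => ?_
      fin_cases i <;> fin_cases j <;> first
        | exact absurd hij (by decide)
        | exact .inl h1
        | exact .inl h2
        | exact .inl h3
        | exact .inl h4
        | exact .inl h5
        | exact .inl hs
        | exact .inr h1
        | exact .inr h2
        | exact .inr h3
        | exact .inr h4
        | exact .inr h5
  refine hg.sum_two_steps hh (fun G a c h0 => ?_) hvw
  obtain ⟨d, -, hd⟩ := Finset.exists_ne_zero_of_sum_ne_zero h0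
  obtain ⟨b, -, hb⟩ := Finset.exists_ne_zero_of_sum_ne_zero hd
  exact ⟨b, (hW.supp hb).1, (hW.supp hb).2.1⟩

open Classical in
/-- A sum over all walks on four nodes with one of them prescribed is determined by the stable
colour of the prescribed node. -/
theorem WalkInv.sum_eq (hh : 3 ≤ h) {W : (G : ColoredGraph C) → (Fin 4 → Fin G.n) → ℚ}
    (hW : WalkInv h W) {G H : ColoredGraph C} {v : Fin G.n} {w : Fin H.n}
    (hvw : SameStable h G H (v, v) (w, w)) (r : Fin 4) :
    (∑ x, if x r = v then W G x else 0) = ∑ y, if y r = w then W H y else 0 := by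
  have key0 : ∀ {W : (G : ColoredGraph C) → (Fin 4 → Fin G.n) → ℚ} (G : ColoredGraph C)
      (v : Fin G.n), (∑ x, if x 0 = v then W G x else 0) = ∑ c, ∑ d, ∑ b, W G ![v, b, c, d] := by
    intro W G v
    rw [sum_fin_four, Finset.sum_eq_single v]
    · simp only [Matrix.cons_val_zero, if_true]
      rw [Finset.sum_comm]
      exact Finset.sum_congr rfl fun c _ => Finset.sum_comm
    · intro a _ ha
      simp [ha]
    · simp
  have key1 : ∀ {W : (G : ColoredGraph C) → (Fin 4 → Fin G.n) → ℚ} (G : ColoredGraph C)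
      (v : Fin G.n), (∑ x, if x 1 = v then W G x else 0) = ∑ c, ∑ d, ∑ a, W G ![a, v, c, d] := by
    intro W G v
    rw [sum_fin_four, Finset.sum_comm, Finset.sum_eq_single v]
    · simp only [Matrix.cons_val_one, Matrix.cons_val_zero, if_true]
      rw [Finset.sum_comm]
      exact Finset.sum_congr rfl fun c _ => Finset.sum_comm
    · intro a _ ha
      simp [ha]
    · simp
  have hrev : ∀ (G : ColoredGraph C) (v : Fin G.n) (r : Fin 4),
      (∑ x, if x r = v then W G x else 0) =
        ∑ x, if x r.rev = v then W G (x ∘ Fin.rev) else 0 := by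
    intro G v r
    refine Fintype.sum_equiv (Equiv.arrowCongr Fin.revPerm (Equiv.refl _)) _ _ fun x => ?_
    have hx : (Equiv.arrowCongr Fin.revPerm (Equiv.refl _)) x = x ∘ Fin.rev := rfl
    simp [hx, Function.comp_def]
  fin_cases r
  · exact (key0 G v).trans ((hW.sum_zero hh hvw).trans (key0 H w).symm)
  · exact (key1 G v).trans ((hW.sum_one hh hvw).trans (key1 H w).symm)
  · rw [hrev, hrev]
    exact (key1 (W := fun G x => W G (x ∘ Fin.rev)) G v).trans
      ((hW.reverse.sum_one hh hvw).trans (key1 (W := fun G x => W G (x ∘ Fin.rev)) H w).symm)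
  · rw [hrev, hrev]
    exact (key0 (W := fun G x => W G (x ∘ Fin.rev)) G v).trans
      ((hW.reverse.sum_zero hh hvw).trans (key0 (W := fun G x => W G (x ∘ Fin.rev)) H w).symm)

end Tuples

/-! ### From subgraphs to injective maps -/

section Counting

variable {k n : ℕ}

/-- An injective homomorphism. -/
def IsCopy (F : SimpleGraph (Fin k)) (G : SimpleGraph (Fin n)) (f : Fin k → Fin n) : Prop :=
  Function.Injective f ∧ ∀ i j, F.Adj i j → G.Adj (f i) (f j)

/-- An embedding of graphs. -/
def IsInd (F : SimpleGraph (Fin k)) (G : SimpleGraph (Fin n)) (f : Fin k → Fin n) : Prop :=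
  Function.Injective f ∧ ∀ i j, F.Adj i j ↔ G.Adj (f i) (f j)

open Classical in
/-- The number of maps with the property `Q` that send `r` to `v`. -/
noncomputable def rootedCount (Q : (Fin k → Fin n) → Prop) (r : Fin k) (v : Fin n) : ℚ :=
  ∑ f, if Q f ∧ f r = v then 1 else 0

open Classical in
theorem card_eq_sum {α : Type*} [Fintype α] (P : α → Prop) :
    (Nat.card {x // P x} : ℚ) = ∑ x, if P x then 1 else 0 := by
  rw [Nat.card_eq_fintype_card, Fintype.card_subtype, Finset.sum_boole]

theorem rootedCount_eq_card (Q : (Fin k → Fin n) → Prop) (r : Fin k) (v : Fin n) :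
    rootedCount Q r v = Nat.card {f // Q f ∧ f r = v} := by
  rw [card_eq_sum, rootedCount]
  exact Finset.sum_congr rfl fun f _ => by congr

theorem sum_rootedCount {Q : (Fin k → Fin n) → Prop} (hQ : ∀ f, Q f → Function.Injective f)
    (v : Fin n) : ∑ r, rootedCount Q r v = Nat.card {f // Q f ∧ ∃ r, f r = v} := by
  classical
  simp only [card_eq_sum, rootedCount]
  rw [Finset.sum_comm]
  refine Finset.sum_congr rfl fun f _ => ?_
  by_cases hf : Q f ∧ ∃ r, f r = v
  · obtain ⟨hf, r, rfl⟩ := hf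
    rw [Finset.sum_eq_single r]
    · simp [hf]
    · intro b _ hb
      simp [(hQ f hf).eq_iff, hb]
    · simp
  · rw [if_neg hf]
    exact Finset.sum_eq_zero fun r _ => if_neg fun h => hf ⟨h.1, r, h.2⟩

/-- Maps onto the members of a family of graphs are counted member by member. -/
theorem card_maps {F : SimpleGraph (Fin k)} {T : Type*} [Finite T] {V : T → Set (Fin n)}
    {K : ∀ t, SimpleGraph (V t)} {Q P : (Fin k → Fin n) → Prop}
    (hmap : ∀ t (φ : F ≃g K t), Q fun i => φ i)
    (hinj : ∀ t t' (φ : F ≃g K t) (φ' : F ≃g K t'), (∀ i, (φ i : Fin n) = φ' i) → t = t')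
    (hsurj : ∀ f, Q f → ∃ t, ∃ φ : F ≃g K t, ∀ i, (φ i : Fin n) = f i) {m : ℕ}
    (hm : ∀ t (φ : F ≃g K t), (P fun i => φ i) → Nat.card {φ : F ≃g K t // P fun i => φ i} = m) :
    Nat.card {f // Q f ∧ P f} = Nat.card {t // ∃ φ : F ≃g K t, P fun i => φ i} * m := by
  classical
  have := Fintype.ofFinite T
  have hfin : ∀ t, Finite {φ : F ≃g K t // P fun i => φ i} := fun t =>
    Finite.of_injective (fun φ => (φ.1 : Fin k → V t)) fun φ ψ h =>
      Subtype.ext (DFunLike.coe_injective h)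
  -- A map with property `Q` is the same as a member `t` together with an isomorphism onto it.
  let Ψ : (Σ t, {φ : F ≃g K t // P fun i => φ i}) → {f // Q f ∧ P f} :=
    fun x => ⟨fun i => x.2.1 i, hmap _ _, x.2.2⟩
  have hΨ : Function.Bijective Ψ := by
    constructor
    · rintro ⟨t, φ, hφ⟩ ⟨t', φ', hφ'⟩ he
      have he' : ∀ i, (φ i : Fin n) = φ' i := fun i => congrFun (congrArg Subtype.val he) i
      obtain rfl := hinj t t' φ φ' he'
      have : φ = φ' := RelIso.ext fun i => Subtype.ext (he' i)
      subst this
      rfl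
    · rintro ⟨f, hQ, hP⟩
      obtain ⟨t, φ, h⟩ := hsurj f hQ
      obtain rfl : (fun i => (φ i : Fin n)) = f := funext h
      exact ⟨⟨t, φ, hP⟩, rfl⟩
  rw [← Nat.card_eq_of_bijective Ψ hΨ, Nat.card_sigma, Nat.card_eq_fintype_card,
    Fintype.card_subtype, Finset.card_filter, Finset.sum_mul]
  refine Finset.sum_congr rfl fun t _ => ?_
  split_ifs with h
  · obtain ⟨φ, hφ⟩ := h
    rw [hm t φ hφ, one_mul]
  · have : IsEmpty {φ : F ≃g K t // P fun i => φ i} := ⟨fun φ => h ⟨φ.1, φ.2⟩⟩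
    simp

/-- If there are isomorphisms onto a given member sending `r` to `v`, any two differ by an
automorphism of `F` that fixes `r`. -/
theorem card_maps_at {F : SimpleGraph (Fin k)} {T : Type*} [Finite T] {V : T → Set (Fin n)}
    {K : ∀ t, SimpleGraph (V t)} {Q : (Fin k → Fin n) → Prop}
    (hmap : ∀ t (φ : F ≃g K t), Q fun i => φ i)
    (hinj : ∀ t t' (φ : F ≃g K t) (φ' : F ≃g K t'), (∀ i, (φ i : Fin n) = φ' i) → t = t')
    (hsurj : ∀ f, Q f → ∃ t, ∃ φ : F ≃g K t, ∀ i, (φ i : Fin n) = f i) (r : Fin k) (v : Fin n) :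
    (Nat.card {t // ∃ φ : F ≃g K t, (φ r : Fin n) = v} : ℚ) =
      rootedCount Q r v / Nat.card {α : F ≃g F // α r = r} := by
  have hfin : Finite {α : F ≃g F // α r = r} :=
    Finite.of_injective (fun φ => (φ.1 : Fin k → Fin k)) fun φ ψ h =>
      Subtype.ext (DFunLike.coe_injective h)
  have hne : Nonempty {α : F ≃g F // α r = r} := ⟨⟨RelIso.refl _, rfl⟩⟩
  rw [rootedCount_eq_card, eq_div_iff (by exact_mod_cast Nat.card_pos.ne')]
  norm_cast
  refine (card_maps hmap hinj hsurj (P := fun f => f r = v) fun t φ hφ => ?_).symm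
  refine Nat.card_congr ⟨fun ψ => ⟨ψ.1.trans φ.symm, ?_⟩, fun α => ⟨α.1.trans φ, ?_⟩, ?_, ?_⟩
  · have : ψ.1 r = φ r := Subtype.ext (ψ.2.trans hφ.symm)
    simp [this]
  · simpa [α.2] using hφ
  · intro ψ
    ext i
    simp
  · intro α
    ext i
    simp

/-- Any two isomorphisms onto the same member differ by an arbitrary automorphism of `F`; by
injectivity each map meets `v` in at most one `r`. -/
theorem card_maps_through {F : SimpleGraph (Fin k)} {T : Type*} [Finite T] {V : T → Set (Fin n)}
    {K : ∀ t, SimpleGraph (V t)} {Q : (Fin k → Fin n) → Prop}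
    (hQ : ∀ f, Q f → Function.Injective f)
    (hmap : ∀ t (φ : F ≃g K t), Q fun i => φ i)
    (hinj : ∀ t t' (φ : F ≃g K t) (φ' : F ≃g K t'), (∀ i, (φ i : Fin n) = φ' i) → t = t')
    (hsurj : ∀ f, Q f → ∃ t, ∃ φ : F ≃g K t, ∀ i, (φ i : Fin n) = f i) (v : Fin n) :
    (Nat.card {t // v ∈ V t ∧ Nonempty (F ≃g K t)} : ℚ) =
      (∑ r, rootedCount Q r v) / Nat.card (F ≃g F) := by
  have hfin : Finite (F ≃g F) :=
    Finite.of_injective (fun φ => (φ : Fin k → Fin k)) DFunLike.coe_injective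
  have hne : Nonempty (F ≃g F) := ⟨RelIso.refl _⟩
  have hiff : ∀ t, (v ∈ V t ∧ Nonempty (F ≃g K t)) ↔ ∃ φ : F ≃g K t, ∃ r, (φ r : Fin n) = v := by
    refine fun t => ⟨?_, ?_⟩
    · rintro ⟨hv, ⟨φ⟩⟩
      exact ⟨φ, φ.symm ⟨v, hv⟩, by simp⟩
    · rintro ⟨φ, r, rfl⟩
      exact ⟨(φ r).2, ⟨φ⟩⟩
  rw [sum_rootedCount hQ, eq_div_iff (by exact_mod_cast Nat.card_pos.ne')]
  simp only [hiff]
  norm_cast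
  refine (card_maps hmap hinj hsurj (P := fun f => ∃ r, f r = v) fun t φ hφ => ?_).symm
  have hv := ((hiff t).2 ⟨φ, hφ⟩).1
  refine Nat.card_congr ⟨fun ψ => ψ.1.trans φ.symm,
    fun α => ⟨α.trans φ, (α.trans φ).symm ⟨v, hv⟩, by simp⟩, ?_, ?_⟩
  · intro ψ
    ext i
    simp
  · intro α
    ext i
    simp

variable (F : SimpleGraph (Fin k)) (G : SimpleGraph (Fin n))

theorem isCopy_iso (S : G.Subgraph) (φ : F ≃g S.coe) : IsCopy F G fun i => φ i :=
  ⟨Subtype.val_injective.comp φ.injective, fun _ _ h => S.adj_sub (φ.map_adj_iff.2 h)⟩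

theorem subgraph_eq_of_iso (S S' : G.Subgraph) (φ : F ≃g S.coe) (φ' : F ≃g S'.coe)
    (h : ∀ i, (φ i : Fin n) = φ' i) : S = S' := by
  have aux : ∀ (S S' : G.Subgraph) (φ : F ≃g S.coe) (φ' : F ≃g S'.coe),
      (∀ i, (φ i : Fin n) = φ' i) → S ≤ S' := by
    intro S S' φ φ' h
    constructor
    · intro x hx
      obtain ⟨i, hi⟩ := φ.surjective ⟨x, hx⟩
      have : x = φ' i := by rw [← h i, hi]
      rw [this]
      exact (φ' i).2
    · intro x y hxy
      obtain ⟨i, hi⟩ := φ.surjective ⟨x, S.edge_vert hxy⟩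
      obtain ⟨j, hj⟩ := φ.surjective ⟨y, S.edge_vert hxy.symm⟩
      have hx : x = φ' i := by rw [← h i, hi]
      have hy : y = φ' j := by rw [← h j, hj]
      have hF : F.Adj i j := by
        rw [← φ.map_adj_iff, hi, hj]
        exact hxy
      rw [hx, hy]
      exact φ'.map_adj_iff.2 hF
  exact le_antisymm (aux _ _ φ φ' h) (aux _ _ φ' φ fun i => (h i).symm)

theorem exists_subgraph_iso (f : Fin k → Fin n) (hf : IsCopy F G f) :
    ∃ S : G.Subgraph, ∃ φ : F ≃g S.coe, ∀ i, (φ i : Fin n) = f i := by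
  let g : SimpleGraph.Copy F G := ⟨⟨f, fun {a b} => hf.2 a b⟩, hf.1⟩
  exact ⟨g.toSubgraph, g.isoToSubgraph, fun i => rfl⟩

theorem isInd_iso (s : Set (Fin n)) (φ : F ≃g G.induce s) : IsInd F G fun i => φ i :=
  ⟨Subtype.val_injective.comp φ.injective, fun _ _ => φ.map_adj_iff.symm⟩

theorem set_eq_of_iso (s s' : Set (Fin n)) (φ : F ≃g G.induce s) (φ' : F ≃g G.induce s')
    (h : ∀ i, (φ i : Fin n) = φ' i) : s = s' := by
  have aux : ∀ (s s' : Set (Fin n)) (φ : F ≃g G.induce s) (φ' : F ≃g G.induce s'),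
      (∀ i, (φ i : Fin n) = φ' i) → s ⊆ s' := by
    intro s s' φ φ' h x hx
    obtain ⟨i, hi⟩ := φ.surjective ⟨x, hx⟩
    have : x = φ' i := by rw [← h i, hi]
    rw [this]
    exact (φ' i).2
  exact (aux _ _ φ φ' h).antisymm (aux _ _ φ' φ fun i => (h i).symm)

theorem exists_induce_iso (f : Fin k → Fin n) (hf : IsInd F G f) :
    ∃ s : Set (Fin n), ∃ φ : F ≃g G.induce s, ∀ i, (φ i : Fin n) = f i :=
  ⟨Set.range f, ⟨Equiv.ofInjective f hf.1, fun {a b} => (hf.2 a b).symm⟩, fun _ => rfl⟩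

theorem copiesAt_eq (r : Fin k) (v : Fin n) :
    (copiesAt F r G v : ℚ) = rootedCount (IsCopy F G) r v / Nat.card {α : F ≃g F // α r = r} :=
  card_maps_at (isCopy_iso F G) (subgraph_eq_of_iso F G) (exists_subgraph_iso F G) r v

theorem copiesThrough_eq (v : Fin n) :
    (copiesThrough F G v : ℚ) = (∑ r, rootedCount (IsCopy F G) r v) / Nat.card (F ≃g F) :=
  card_maps_through (fun _ h => h.1) (isCopy_iso F G) (subgraph_eq_of_iso F G)
    (exists_subgraph_iso F G) v

theorem inducedAt_eq (r : Fin k) (v : Fin n) :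
    (inducedAt F r G v : ℚ) = rootedCount (IsInd F G) r v / Nat.card {α : F ≃g F // α r = r} :=
  card_maps_at (isInd_iso F G) (set_eq_of_iso F G) (exists_induce_iso F G) r v

theorem inducedThrough_eq (v : Fin n) :
    (inducedThrough F G v : ℚ) = (∑ r, rootedCount (IsInd F G) r v) / Nat.card (F ≃g F) :=
  card_maps_through (fun _ h => h.1) (isInd_iso F G) (set_eq_of_iso F G)
    (exists_induce_iso F G) v

end Counting

/-! ### Counts determined by the diagonal colour -/

section Det

variable {k : ℕ}

/-- The number of injective homomorphisms from `F` that send `r` to a node is determined by the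
stable diagonal colour of the node. -/
def CopyDet (C : Type u) (h : ℕ) (F : SimpleGraph (Fin k)) (r : Fin k) : Prop :=
  ∀ (G H : ColoredGraph C) (v : Fin G.n) (w : Fin H.n), SameStable h G H (v, v) (w, w) →
    rootedCount (IsCopy F G.graph) r v = rootedCount (IsCopy F H.graph) r w

/-- The number of embeddings of `F` that send `r` to a node is determined by the stable diagonal
colour of the node. -/
def IndDet (C : Type u) (h : ℕ) (F : SimpleGraph (Fin k)) (r : Fin k) : Prop :=
  ∀ (G H : ColoredGraph C) (v : Fin G.n) (w : Fin H.n), SameStable h G H (v, v) (w, w) →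
    rootedCount (IsInd F G.graph) r v = rootedCount (IsInd F H.graph) r w

variable {C : Type u} {h : ℕ} {F : SimpleGraph (Fin k)}

theorem CopyDet.canCount_at {r : Fin k} (hd : CopyDet C h F r) : CanCount C h (copiesAt F r) :=
  NodeDet.canCount fun G H v w hs => by
    have := hd G H v w hs
    exact_mod_cast (copiesAt_eq F G.graph r v).trans (this ▸ (copiesAt_eq F H.graph r w).symm)

theorem canCount_copiesThrough (hd : ∀ r, CopyDet C h F r) : CanCount C h (copiesThrough F) :=
  NodeDet.canCount fun G H v w hs => by
    have := Finset.sum_congr rfl fun r (_ : r ∈ Finset.univ) => hd r G H v w hs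
    exact_mod_cast (copiesThrough_eq F G.graph v).trans
      (this ▸ (copiesThrough_eq F H.graph w).symm)

theorem IndDet.canCount_at {r : Fin k} (hd : IndDet C h F r) : CanCount C h (inducedAt F r) :=
  NodeDet.canCount fun G H v w hs => by
    have := hd G H v w hs
    exact_mod_cast (inducedAt_eq F G.graph r v).trans (this ▸ (inducedAt_eq F H.graph r w).symm)

theorem canCount_inducedThrough (hd : ∀ r, IndDet C h F r) : CanCount C h (inducedThrough F) :=
  NodeDet.canCount fun G H v w hs => by
    have := Finset.sum_congr rfl fun r (_ : r ∈ Finset.univ) => hd r G H v w hs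
    exact_mod_cast (inducedThrough_eq F G.graph v).trans
      (this ▸ (inducedThrough_eq F H.graph w).symm)

end Det

/-! ### Connected graphs on four vertices -/

section FourVertices

/-- The adjacency matrix of the graph on four vertices with prescribed edges. -/
def adjOfEdges (p₁ p₂ p₃ p₄ p₅ p₆ : Bool) : Fin 4 → Fin 4 → Bool :=
  ![![false, p₁, p₂, p₃], ![p₁, false, p₄, p₅], ![p₂, p₄, false, p₆], ![p₃, p₅, p₆, false]]

theorem adjOfEdges_iff (F : SimpleGraph (Fin 4)) [DecidableRel F.Adj] (i j : Fin 4) :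
    adjOfEdges (F.Adj 0 1) (F.Adj 0 2) (F.Adj 0 3) (F.Adj 1 2) (F.Adj 1 3) (F.Adj 2 3) i j = true ↔
      F.Adj i j := by
  fin_cases i <;> fin_cases j <;> simp [adjOfEdges, F.adj_comm 1 0, F.adj_comm 2 0,
    F.adj_comm 3 0, F.adj_comm 2 1, F.adj_comm 3 1, F.adj_comm 3 2]

set_option synthInstance.maxSize 1000 in
set_option synthInstance.maxHeartbeats 200000 in
/-- A connected graph on four vertices has a Hamiltonian path or is a claw. -/
theorem exists_path_or_claw {F : SimpleGraph (Fin 4)} (hF : F.Connected) :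
    (∃ σ : Equiv.Perm (Fin 4), F.Adj (σ 0) (σ 1) ∧ F.Adj (σ 1) (σ 2) ∧ F.Adj (σ 2) (σ 3)) ∨
      ∃ c, ∀ i j, F.Adj i j ↔ i ≠ j ∧ (i = c ∨ j = c) := by
  -- There are 64 adjacency matrices. Connectivity enters in decidable form: an edge leaves every
  -- proper vertex set that contains 0.
  have key : ∀ p₁ p₂ p₃ p₄ p₅ p₆ : Bool,
      (∀ s : Finset (Fin 4), 0 ∈ s → s ≠ Finset.univ →
        ∃ i ∈ s, ∃ j ∉ s, adjOfEdges p₁ p₂ p₃ p₄ p₅ p₆ i j = true) →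
      (∃ σ : Equiv.Perm (Fin 4), adjOfEdges p₁ p₂ p₃ p₄ p₅ p₆ (σ 0) (σ 1) = true ∧
        adjOfEdges p₁ p₂ p₃ p₄ p₅ p₆ (σ 1) (σ 2) = true ∧
        adjOfEdges p₁ p₂ p₃ p₄ p₅ p₆ (σ 2) (σ 3) = true) ∨
      ∃ c, ∀ i j, adjOfEdges p₁ p₂ p₃ p₄ p₅ p₆ i j = true ↔ i ≠ j ∧ (i = c ∨ j = c) := by
    decide +kernel
  classical
  have hcut : ∀ s : Finset (Fin 4), 0 ∈ s → s ≠ Finset.univ → ∃ i ∈ s, ∃ j ∉ s, F.Adj i j := by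
    intro s h0 hs
    obtain ⟨y, hy⟩ : ∃ y, y ∉ s := by
      by_contra! hall
      exact hs (Finset.eq_univ_iff_forall.2 hall)
    obtain ⟨w⟩ := hF.preconnected 0 y
    obtain ⟨d, -, h1, h2⟩ := w.exists_boundary_dart (s : Set (Fin 4)) (by simpa using h0)
      (by simpa using hy)
    exact ⟨_, by simpa using h1, _, by simpa using h2, d.adj⟩
  have := key (F.Adj 0 1) (F.Adj 0 2) (F.Adj 0 3) (F.Adj 1 2) (F.Adj 1 3) (F.Adj 2 3)
  simp only [adjOfEdges_iff] at this
  exact this hcut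

variable {C : Type u} {h : ℕ} {F : SimpleGraph (Fin 4)}

open Classical in
theorem rootedCount_perm {n : ℕ} (Q : (Fin 4 → Fin n) → Prop) (σ : Equiv.Perm (Fin 4)) (r : Fin 4)
    (v : Fin n) : rootedCount Q r v =
      ∑ x : Fin 4 → Fin n, if Q (x ∘ σ.symm) ∧ x (σ.symm r) = v then 1 else 0 := by
  refine Fintype.sum_equiv (Equiv.arrowCongr σ.symm (Equiv.refl _)) _ _ fun f => ?_
  have hx : (Equiv.arrowCongr σ.symm (Equiv.refl _)) f = f ∘ σ := rfl
  simp [hx, Function.comp_def]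

theorem TupleStable.isInd_comp {G H : ColoredGraph C} {x : Fin 4 → Fin G.n} {y : Fin 4 → Fin H.n}
    (hs : TupleStable h G H x y) (τ : Fin 4 → Fin 4) :
    IsInd F G.graph (x ∘ τ) ↔ IsInd F H.graph (y ∘ τ) := by
  simp only [IsInd, Function.Injective, Function.comp_apply, hs.adj_iff, hs.eq_iff]

/-- Read along the Hamiltonian path, every embedding is a walk, and being an embedding depends only
on equality and adjacency of pairs. -/
theorem indDet_of_path (hh : 3 ≤ h) (σ : Equiv.Perm (Fin 4)) (h01 : F.Adj (σ 0) (σ 1))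
    (h12 : F.Adj (σ 1) (σ 2)) (h23 : F.Adj (σ 2) (σ 3)) (r : Fin 4) : IndDet C h F r := by
  classical
  intro G H v w hs
  have hW : WalkInv (C := C) h fun G x => if IsInd F G.graph (x ∘ σ.symm) then 1 else 0 := by
    refine ⟨fun G H x y _ _ hxy => if_congr (hxy.isInd_comp _) rfl rfl, fun G x h0 => ?_⟩
    have hi := (ite_ne_right_iff.1 h0).1.2
    refine ⟨?_, ?_, ?_⟩
    · simpa using (hi _ _).1 h01
    · simpa using (hi _ _).1 h12
    · simpa using (hi _ _).1 h23
  rw [rootedCount_perm _ σ, rootedCount_perm _ σ]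
  have := hW.sum_eq hh hs (σ.symm r)
  simp only [← ite_and] at this
  simpa only [and_comm] using this

open Classical in
/-- Copies of `F` are embeddings of the graphs containing `F`. -/
theorem rootedCount_isCopy {n k : ℕ} (F : SimpleGraph (Fin k)) (G : SimpleGraph (Fin n)) (r : Fin k)
    (v : Fin n) : rootedCount (IsCopy F G) r v =
      ∑ F' : SimpleGraph (Fin k), if F ≤ F' then rootedCount (IsInd F' G) r v else 0 := by
  rw [← Finset.sum_filter]
  simp only [rootedCount]
  rw [Finset.sum_comm]
  refine Finset.sum_congr rfl fun f _ => ?_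
  by_cases hf : IsCopy F G f ∧ f r = v
  -- An injective map embeds exactly one graph, the pullback of `G`.
  · rw [if_pos hf, Finset.sum_eq_single_of_mem (G.comap f)]
    · rw [if_pos ⟨⟨hf.1.1, fun i j => Iff.rfl⟩, hf.2⟩]
    · exact Finset.mem_filter.2 ⟨Finset.mem_univ _, fun i j => hf.1.2 i j⟩
    · intro F' _ hne
      refine if_neg fun hi => hne ?_
      ext i j
      exact hi.1.2 i j
  · rw [if_neg hf]
    refine (Finset.sum_eq_zero fun F' hF' => if_neg fun hi =>
      hf ⟨⟨hi.1.1, fun i j hij => ?_⟩, hi.2⟩).symm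
    exact (hi.1.2 i j).1 ((Finset.mem_filter.1 hF').2 hij)

open Classical in
theorem sum_claw_leaf {n : ℕ} {G : SimpleGraph (Fin n)} {a b c : Fin n} (hab : G.Adj b a)
    (hbc : G.Adj b c) (hac : a ≠ c) :
    (∑ d, if G.Adj b d ∧ d ≠ a ∧ d ≠ c then (1 : ℚ) else 0) =
      (∑ d, if G.Adj b d then 1 else 0) - 2 := by
  have : ∀ d, (if G.Adj b d ∧ d ≠ a ∧ d ≠ c then (1 : ℚ) else 0) =
      (if G.Adj b d then 1 else 0) - (if d = a then 1 else 0) - (if d = c then 1 else 0) := by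
    intro d
    by_cases h1 : d = a
    · subst h1
      simp [hab, hac]
    · by_cases h2 : d = c
      · subst h2
        simp [hbc, h1]
      · simp [h1, h2]
  simp only [this, Finset.sum_sub_distrib, Finset.sum_ite_eq', Finset.mem_univ, if_true]
  ring

/-- The condition on the leaf `x 3` is split off, so that this leaf can be summed out. -/
theorem isCopy_claw {n : ℕ} {G : SimpleGraph (Fin n)} (σ : Equiv.Perm (Fin 4))
    (hF : ∀ i j, F.Adj i j ↔ i ≠ j ∧ (i = σ 1 ∨ j = σ 1)) (x : Fin 4 → Fin n) :
    IsCopy F G (x ∘ σ.symm) ↔ (G.Adj (x 1) (x 0) ∧ G.Adj (x 1) (x 2) ∧ x 0 ≠ x 2) ∧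
      G.Adj (x 1) (x 3) ∧ x 3 ≠ x 0 ∧ x 3 ≠ x 2 := by
  have hadj : (∀ i j, F.Adj i j → G.Adj ((x ∘ σ.symm) i) ((x ∘ σ.symm) j)) ↔
      ∀ i j : Fin 4, i ≠ j → (i = 1 ∨ j = 1) → G.Adj (x i) (x j) := by
    simp only [hF]
    constructor
    · intro hall i j hij h1
      simpa using hall (σ i) (σ j) ⟨by simpa using hij, by simpa using h1⟩
    · rintro hall i j ⟨hij, h1⟩
      refine hall _ _ (by simpa using hij) ?_
      simpa [Equiv.symm_apply_eq] using h1
  have hinj : Function.Injective (x ∘ σ.symm) ↔ ∀ i j : Fin 4, i < j → x i ≠ x j := by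
    rw [Function.Injective.of_comp_iff' _ σ.symm.bijective]
    constructor
    · exact fun hx i j hij he => hij.ne (hx he)
    · intro hx i j he
      rcases lt_trichotomy i j with hij | hij | hij
      · exact absurd he (hx i j hij)
      · exact hij
      · exact absurd he.symm (hx j i hij)
  rw [IsCopy, hadj, hinj]
  constructor
  · rintro ⟨h1, h2⟩
    exact ⟨⟨h2 1 0 (by decide) (by decide), h2 1 2 (by decide) (by decide), h1 0 2 (by decide)⟩,
      h2 1 3 (by decide) (by decide), (h1 0 3 (by decide)).symm, (h1 2 3 (by decide)).symm⟩
  · rintro ⟨⟨h10, h12, h02⟩, h13, h30, h32⟩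
    refine ⟨fun i j hij => ?_, fun i j hij h1 => ?_⟩
    · fin_cases i <;> fin_cases j <;> first
        | exact absurd hij (by decide)
        | exact h10.ne.symm
        | exact h12.ne
        | exact h13.ne
        | exact h02
        | exact h30.symm
        | exact h32.symm
    · fin_cases i <;> fin_cases j <;> first
        | exact h10
        | exact h10.symm
        | exact h12
        | exact h12.symm
        | exact h13
        | exact h13.symm
        | exact absurd rfl hij
        | exact absurd h1 (by decide)

/-- The third leaf can be any neighbour of the centre other than the first two, which gives the
degree minus 2. The free position of the walk is filled by the centre: `x₀x₁x₂x₁`. -/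
theorem copyDet_claw (hh : 3 ≤ h) {c : Fin 4} (hF : ∀ i j, F.Adj i j ↔ i ≠ j ∧ (i = c ∨ j = c))
    (r : Fin 4) : CopyDet C h F r := by
  classical
  intro G H v w hs
  -- The centre goes to position 1 and the root to 0 or 1, so the root is never the leaf summed out.
  obtain ⟨σ, rfl, hr⟩ : ∃ σ : Equiv.Perm (Fin 4), σ 1 = c ∧ (σ.symm r = 0 ∨ σ.symm r = 1) := by
    clear hF
    revert r c
    decide +kernel
  have hW : WalkInv (C := C) h fun G x => if x 3 = x 1 then
      if G.graph.Adj (x 1) (x 0) ∧ G.graph.Adj (x 1) (x 2) ∧ x 0 ≠ x 2 then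
        nbrDegree G (x 0) (x 1) - 2 else 0 else 0 := by
    refine ⟨fun G H x y _ _ hxy => ?_, fun G x h0 => ?_⟩
    · simp only [hxy.adj_iff, hxy.eq_iff, ne_eq, pairInv_nbrDegree hh (hxy 0 1 (by decide))]
    · obtain ⟨h31, h0⟩ := ite_ne_right_iff.1 h0
      obtain ⟨⟨h1, h2, -⟩, -⟩ := ite_ne_right_iff.1 h0
      exact ⟨h1.symm, h2, by rw [h31]; exact h2.symm⟩
  have key : ∀ (G : ColoredGraph C) (v : Fin G.n), rootedCount (IsCopy F G.graph) r v =
      ∑ x : Fin 4 → Fin G.n, if x (σ.symm r) = v then if x 3 = x 1 then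
      if G.graph.Adj (x 1) (x 0) ∧ G.graph.Adj (x 1) (x 2) ∧ x 0 ≠ x 2 then
        nbrDegree G (x 0) (x 1) - 2 else 0 else 0 else 0 := by
    intro G v
    rw [rootedCount_perm _ σ, sum_fin_four, sum_fin_four]
    refine Finset.sum_congr rfl fun a _ => Finset.sum_congr rfl fun b _ =>
      Finset.sum_congr rfl fun c _ => ?_
    have hroot : ∃ p : Prop, ∀ d, (![a, b, c, d] : Fin 4 → Fin G.n) (σ.symm r) = v ↔ p := by
      rcases hr with hr | hr
      · exact ⟨a = v, fun d => by rw [hr]; rfl⟩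
      · exact ⟨b = v, fun d => by rw [hr]; rfl⟩
    obtain ⟨p, hp⟩ := hroot
    simp only [isCopy_claw σ hF, hp]
    by_cases hpt : p
    · by_cases hq : G.graph.Adj b a ∧ G.graph.Adj b c ∧ a ≠ c
      · have := sum_claw_leaf hq.1 hq.2.1 hq.2.2
        simp [hpt, hq, hq.1.symm, nbrDegree] at this ⊢
        exact this
      · rw [Finset.sum_eq_zero fun d _ => if_neg fun hd => hq hd.1.1,
          Finset.sum_eq_zero fun d _ => ?_]
        split_ifs <;> first | rfl | exact absurd ‹_› hq
    · simp [hpt]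
  rw [key, key]
  exact hW.sum_eq hh hs _

/-- Every proper supergraph of `F` on the same vertices has a Hamiltonian path, so its embeddings
are already determined. The numbers of copies and of embeddings of `F` thus differ by a determined
quantity, and either one yields the other. -/
theorem copyDet_indDet (hh : 3 ≤ h) (hF : F.Connected) (r : Fin 4) :
    CopyDet C h F r ∧ IndDet C h F r := by
  classical
  have hpath : ∀ F' : SimpleGraph (Fin 4), F ≤ F' → F' ≠ F → IndDet C h F' r := by
    intro F' hle hne
    have hF' : F'.Connected := hF.mono hle
    rcases exists_path_or_claw hF' with ⟨σ, h1, h2, h3⟩ | ⟨c', hc'⟩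
    · exact indDet_of_path hh σ h1 h2 h3 r
    · exfalso
      apply hne
      -- A claw contains no Hamiltonian path, whose outer edges are disjoint, and a claw inside a
      -- claw has the same centre.
      rcases exists_path_or_claw hF with ⟨σ, h1, h2, h3⟩ | ⟨c, hc⟩
      · have h1' := ((hc' _ _).1 (hle h1)).2
        have h2' := ((hc' _ _).1 (hle h2)).2
        have h3' := ((hc' _ _).1 (hle h3)).2
        have key : ∀ (σ : Equiv.Perm (Fin 4)) (c' : Fin 4), (σ 0 = c' ∨ σ 1 = c') →
            (σ 2 = c' ∨ σ 3 = c') → False := by decide +kernel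
        exact (key σ c' h1' h3').elim
      · have key : ∀ c c' : Fin 4, (∀ i j : Fin 4, i ≠ j ∧ (i = c ∨ j = c) →
            i ≠ j ∧ (i = c' ∨ j = c')) → c' = c := by decide +kernel
        have hcc := key c c' fun i j hij => (hc' i j).1 (hle ((hc i j).2 hij))
        ext i j
        rw [hc', hc, hcc]
  have hiff : CopyDet C h F r ↔ IndDet C h F r := by
    refine forall₄_congr fun G H v w => imp_congr_right fun hs => ?_
    rw [rootedCount_isCopy, rootedCount_isCopy, Fintype.sum_eq_add_sum_compl F,
      Fintype.sum_eq_add_sum_compl F, if_pos le_rfl, if_pos le_rfl,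
      Finset.sum_congr rfl fun F' hF' => ?_, add_left_inj]
    split_ifs with hle
    · exact hpath F' hle (by simpa using hF') G H v w hs
    · rfl
  rcases exists_path_or_claw hF with ⟨σ, h1, h2, h3⟩ | ⟨c, hc⟩
  · have := indDet_of_path (C := C) hh σ h1 h2 h3 r
    exact ⟨hiff.2 this, this⟩
  · have := copyDet_claw (C := C) hh hc r
    exact ⟨this, hiff.1 this⟩

end FourVertices

/-! ### Cycles and paths with four edges -/

section Cycles

variable {C : Type u} {h : ℕ}

theorem injective_vecCons {α : Type*} {k : ℕ} {a : α} {x : Fin k → α} :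
    Function.Injective (Matrix.vecCons a x) ↔ a ∉ Set.range x ∧ Function.Injective x :=
  Fin.cons_injective_iff

theorem injective_vecEmpty {α : Type*} : Function.Injective (![] : Fin 0 → α) :=
  Function.injective_of_subsingleton _

theorem isCopy_cycleGraph {m n : ℕ} {G : SimpleGraph (Fin n)} {f : Fin (m + 2) → Fin n} :
    IsCopy (SimpleGraph.cycleGraph (m + 2)) G f ↔
      Function.Injective f ∧ ∀ i, G.Adj (f i) (f (i + 1)) := by
  refine and_congr_right fun _ => ⟨fun hf i => hf _ _ ?_, fun hf i j hij => ?_⟩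
  · rw [SimpleGraph.cycleGraph_adj]
    exact .inr (by simp)
  · rw [SimpleGraph.cycleGraph_adj, sub_eq_iff_eq_add', sub_eq_iff_eq_add'] at hij
    rcases hij with rfl | rfl
    · exact (hf j).symm
    · exact hf i

theorem isCopy_pathGraph {m n : ℕ} {G : SimpleGraph (Fin n)} {f : Fin (m + 1) → Fin n} :
    IsCopy (SimpleGraph.pathGraph (m + 1)) G f ↔
      Function.Injective f ∧ ∀ i : Fin m, G.Adj (f i.castSucc) (f i.succ) := by
  refine and_congr_right fun _ => ⟨fun hf i => hf _ _ ?_, fun hf i j hij => ?_⟩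
  · rw [SimpleGraph.pathGraph_adj]
    exact .inl (by simp)
  · have key : ∀ i j : Fin (m + 1), i.val + 1 = j.val → G.Adj (f i) (f j) := by
      intro i j hij
      have := hf ⟨i.val, by omega⟩
      rwa [show Fin.succ ⟨i.val, _⟩ = j from Fin.ext hij] at this
    rw [SimpleGraph.pathGraph_adj] at hij
    exact hij.elim (key i j) fun h => (key j i h).symm

-- Rotation moves the root to position 0.
open Classical in
theorem rootedCount_cycleGraph {m n : ℕ} (G : SimpleGraph (Fin n)) (r : Fin (m + 2)) (v : Fin n) :
    rootedCount (IsCopy (SimpleGraph.cycleGraph (m + 2)) G) r v =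
      rootedCount (IsCopy (SimpleGraph.cycleGraph (m + 2)) G) 0 v := by
  refine Fintype.sum_equiv (Equiv.arrowCongr (Equiv.addRight (-r)) (Equiv.refl _)) _ _ fun f => ?_
  have hx : (Equiv.arrowCongr (Equiv.addRight (-r)) (Equiv.refl _)) f = f ∘ (Equiv.addRight r) := by
    ext i
    simp [Equiv.arrowCongr]
  refine if_congr (and_congr ?_ ?_) rfl rfl
  · rw [hx, isCopy_cycleGraph, isCopy_cycleGraph,
      Function.Injective.of_comp_iff' _ (Equiv.addRight r).bijective]
    refine and_congr_right fun _ => ?_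
    rw [← (Equiv.addRight r).forall_congr_right]
    simp only [Function.comp_apply, Equiv.coe_addRight, add_right_comm]
  · rw [hx]
    simp

open Classical in
theorem rootedCount_pathGraph {m n : ℕ} (G : SimpleGraph (Fin n)) (r : Fin (m + 1)) (v : Fin n) :
    rootedCount (IsCopy (SimpleGraph.pathGraph (m + 1)) G) r v =
      rootedCount (IsCopy (SimpleGraph.pathGraph (m + 1)) G) r.rev v := by
  refine Fintype.sum_equiv (Equiv.arrowCongr Fin.revPerm (Equiv.refl _)) _ _ fun f => ?_
  have hx : (Equiv.arrowCongr Fin.revPerm (Equiv.refl _)) f = f ∘ Fin.rev := rfl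
  refine if_congr (and_congr ?_ ?_) rfl rfl
  · rw [hx, isCopy_pathGraph, isCopy_pathGraph,
      Function.Injective.of_comp_iff' _ Fin.rev_bijective]
    refine and_congr_right fun _ => ?_
    rw [← Fin.revPerm.forall_congr_right]
    simp only [Function.comp_apply, Fin.revPerm_apply, ← Fin.rev_succ, ← Fin.rev_castSucc,
      SimpleGraph.adj_comm]
  · rw [hx]
    simp

/-- Setting `x 3 = x 1` turns a triple of consecutive neighbours into a walk on four nodes. -/
theorem sum_fin_three {α : Type*} [Fintype α] [DecidableEq α] (F : (Fin 3 → α) → ℚ) :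
    ∑ f, F f = ∑ x : Fin 4 → α, if x 3 = x 1 then F ![x 0, x 1, x 2] else 0 := by
  rw [sum_fin_four]
  simp only [sum_fin_succ, Fintype.sum_unique]
  refine Finset.sum_congr rfl fun a _ => Finset.sum_congr rfl fun b _ =>
    Finset.sum_congr rfl fun c _ => ?_
  exact (Fintype.sum_ite_eq' b fun _ => F ![a, b, c]).symm

theorem sum_fin_five {α : Type*} [Fintype α] (F : (Fin 5 → α) → ℚ) :
    ∑ f, F f = ∑ x : Fin 4 → α, ∑ e, F ![x 0, x 1, x 2, x 3, e] := by
  simp only [sum_fin_succ, Fintype.sum_unique]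
  rfl

theorem sum_fin_six {α : Type*} [Fintype α] (F : (Fin 6 → α) → ℚ) :
    ∑ f, F f = ∑ x : Fin 4 → α, ∑ e, ∑ f, F ![x 0, x 1, x 2, x 3, e, f] := by
  simp only [sum_fin_succ, Fintype.sum_unique]
  rfl

-- The root must be one of the four walk positions, since the fifth node is summed out.
open Classical in
theorem copyDet_five (hh : 3 ≤ h) {F : SimpleGraph (Fin 5)}
    {W : (G : ColoredGraph C) → (Fin 4 → Fin G.n) → ℚ} (hW : WalkInv h W)
    (hF : ∀ (G : ColoredGraph C) (x : Fin 4 → Fin G.n),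
      (∑ e, if IsCopy F G.graph ![x 0, x 1, x 2, x 3, e] then 1 else 0) = W G x) (s : Fin 4) :
    CopyDet C h F s.castSucc := by
  have key : ∀ (G : ColoredGraph C) (v : Fin G.n), rootedCount (IsCopy F G.graph) s.castSucc v =
      ∑ x, if x s = v then W G x else 0 := by
    intro G v
    rw [rootedCount, sum_fin_five]
    refine Finset.sum_congr rfl fun x _ => ?_
    have hs : ∀ e, (![x 0, x 1, x 2, x 3, e] : Fin 5 → Fin G.n) s.castSucc = x s := by
      intro e
      fin_cases s <;> rfl
    by_cases hx : x s = v
    · simp only [hs, hx, and_true, if_true]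
      exact hF G x
    · simp [hs, hx]
  intro G H v w hs
  rw [key, key]
  exact hW.sum_eq hh hs s

open Classical in
/-- The indicator of a proposition. -/
noncomputable def ind (p : Prop) : ℚ := if p then 1 else 0

theorem ite_eq_ind {p : Prop} [Decidable p] : (if p then (1 : ℚ) else 0) = ind p := by
  by_cases hp : p <;> simp [ind, hp]

theorem ind_true : ind True = 1 := by simp [ind]

theorem ind_false : ind False = 0 := by simp [ind]

theorem sum_ind_ne {α : Type*} [Fintype α] (P : α → Prop) (b : α) :
    ∑ e, ind (P e ∧ e ≠ b) = ∑ e, ind (P e) - ind (P b) := by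
  classical
  rw [eq_sub_iff_add_eq, ← Fintype.sum_ite_eq' b fun e => ind (P e), ← Finset.sum_add_distrib]
  refine Finset.sum_congr rfl fun e _ => ?_
  by_cases he : e = b <;> simp [he, ind]

-- The last node is a neighbour of `x 3` other than `x 0`, `x 1`, `x 2`; of these, `x 2` is always a
-- neighbour, hence the `- 1`.
open Classical in
theorem copyDet_pathGraph_five (hh : 3 ≤ h) (r : Fin 5) :
    CopyDet C h (SimpleGraph.pathGraph 5) r := by
  have hW : WalkInv (C := C) h fun G x =>
      if IsWalk G.graph x ∧ x 0 ≠ x 2 ∧ x 1 ≠ x 3 ∧ x 0 ≠ x 3 then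
      nbrDegree G (x 2) (x 3) - (if G.graph.Adj (x 3) (x 0) then 1 else 0) -
        (if G.graph.Adj (x 3) (x 1) then 1 else 0) - 1 else 0 := by
    refine ⟨fun G H x y hx hy hxy => ?_, fun G x h0 => (ite_ne_right_iff.1 h0).1.1⟩
    simp only [hx, hy, hxy.adj_iff, hxy.eq_iff, ne_eq, pairInv_nbrDegree hh (hxy 2 3 (by decide))]
  have hlt : ∀ s : Fin 4, CopyDet C h (SimpleGraph.pathGraph 5) s.castSucc := by
    refine copyDet_five hh hW fun G x => ?_
    have hiff : ∀ e, IsCopy (SimpleGraph.pathGraph 5) G.graph ![x 0, x 1, x 2, x 3, e] ↔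
        (IsWalk G.graph x ∧ x 0 ≠ x 2 ∧ x 1 ≠ x 3 ∧ x 0 ≠ x 3) ∧
        ((G.graph.Adj (x 3) e ∧ e ≠ x 0) ∧ e ≠ x 1) ∧ e ≠ x 2 := by
      intro e
      rw [isCopy_pathGraph]
      constructor
      · rintro ⟨hi, ha⟩
        exact ⟨⟨⟨ha 0, ha 1, ha 2⟩, hi.ne (a₁ := 0) (a₂ := 2) (by decide),
          hi.ne (a₁ := 1) (a₂ := 3) (by decide), hi.ne (a₁ := 0) (a₂ := 3) (by decide)⟩,
          ⟨⟨ha 3, hi.ne (a₁ := 4) (a₂ := 0) (by decide)⟩, hi.ne (a₁ := 4) (a₂ := 1) (by decide)⟩,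
          hi.ne (a₁ := 4) (a₂ := 2) (by decide)⟩
      · rintro ⟨⟨⟨h1, h2, h3⟩, h4, h5, h6⟩, ⟨⟨h7, h8⟩, h9⟩, h10⟩
        constructor
        · simp [injective_vecCons, injective_vecEmpty, h1.ne, h2.ne, h3.ne, h4, h5, h6, h7.ne,
            h8.symm, h9.symm, h10.symm]
        · intro i
          fin_cases i
          exacts [h1, h2, h3, h7]
    by_cases hx : IsWalk G.graph x ∧ x 0 ≠ x 2 ∧ x 1 ≠ x 3 ∧ x 0 ≠ x 3
    · obtain ⟨⟨h1, h2, h3⟩, h4, h5, h6⟩ := id hx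
      rw [if_pos hx]
      simp only [fun e => (hiff e).trans (and_iff_right hx), nbrDegree, ite_eq_ind]
      rw [sum_ind_ne, sum_ind_ne, sum_ind_ne]
      simp [h3, h3.symm, h4.symm, h2.ne', h1.ne', ind_true]
    · rw [if_neg hx]
      exact Finset.sum_eq_zero fun e _ => if_neg fun hc => hx ((hiff e).1 hc).1
  -- The last vertex is not a walk position; reversing the path moves it to 0.
  induction r using Fin.lastCases with
  | last =>
    intro G H v w hs
    rw [rootedCount_pathGraph G.graph, rootedCount_pathGraph H.graph]
    exact hlt 0 G H v w hs
  | cast s => exact hlt s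

theorem copyDet_cycleGraph_three (hh : 3 ≤ h) (r : Fin 3) :
    CopyDet C h (SimpleGraph.cycleGraph 3) r := by
  classical
  have hW : WalkInv (C := C) h fun G x => if x 3 = x 1 then
      if G.graph.Adj (x 0) (x 1) ∧ G.graph.Adj (x 1) (x 2) ∧ G.graph.Adj (x 2) (x 0) then 1 else 0
      else 0 := by
    refine ⟨fun G H x y _ _ hxy => ?_, fun G x h0 => ?_⟩
    · simp only [hxy.adj_iff, hxy.eq_iff]
    · obtain ⟨h31, h0⟩ := ite_ne_right_iff.1 h0
      obtain ⟨h1, h2, -⟩ := (ite_ne_right_iff.1 h0).1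
      exact ⟨h1, h2, by rw [h31]; exact h2.symm⟩
  have key : ∀ (G : ColoredGraph C) (v : Fin G.n),
      rootedCount (IsCopy (SimpleGraph.cycleGraph 3) G.graph) 0 v =
      ∑ x : Fin 4 → Fin G.n, if x 0 = v then if x 3 = x 1 then
      if G.graph.Adj (x 0) (x 1) ∧ G.graph.Adj (x 1) (x 2) ∧ G.graph.Adj (x 2) (x 0) then 1 else 0
      else 0 else 0 := by
    intro G v
    rw [rootedCount, sum_fin_three]
    refine Finset.sum_congr rfl fun x _ => ?_
    have hiff : IsCopy (SimpleGraph.cycleGraph 3) G.graph ![x 0, x 1, x 2] ↔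
        G.graph.Adj (x 0) (x 1) ∧ G.graph.Adj (x 1) (x 2) ∧ G.graph.Adj (x 2) (x 0) := by
      rw [isCopy_cycleGraph]
      constructor
      · rintro ⟨-, ha⟩
        exact ⟨ha 0, ha 1, ha 2⟩
      · rintro ⟨h1, h2, h3⟩
        constructor
        · simp [injective_vecCons, injective_vecEmpty, h1.ne, h2.ne, h3.ne']
        · intro i
          fin_cases i
          exacts [h1, h2, h3]
    simp only [hiff, Matrix.cons_val_zero]
    split_ifs <;> first | rfl | simp_all
  intro G H v w hs
  rw [rootedCount_cycleGraph G.graph, rootedCount_cycleGraph H.graph, key, key]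
  exact hW.sum_eq hh hs 0

-- The fifth node is a common neighbour of `x 0` and `x 3` other than `x 1` and `x 2`. Given the
-- walk, `x 1` is one exactly if it is adjacent to `x 3`, and `x 2` exactly if it is adjacent to `x
-- 0`.
open Classical in
theorem copyDet_cycleGraph_five (hh : 3 ≤ h) (r : Fin 5) :
    CopyDet C h (SimpleGraph.cycleGraph 5) r := by
  have hW : WalkInv (C := C) h fun G x =>
      if IsWalk G.graph x ∧ x 0 ≠ x 2 ∧ x 1 ≠ x 3 ∧ x 0 ≠ x 3 then
      commonNbrs G (x 0) (x 3) - (if G.graph.Adj (x 1) (x 3) then 1 else 0) -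
        (if G.graph.Adj (x 0) (x 2) then 1 else 0) else 0 := by
    refine ⟨fun G H x y hx hy hxy => ?_, fun G x h0 => (ite_ne_right_iff.1 h0).1.1⟩
    simp only [hx, hy, hxy.adj_iff, hxy.eq_iff, ne_eq, pairInv_commonNbrs hh (hxy 0 3 (by decide))]
  have h0 : CopyDet C h (SimpleGraph.cycleGraph 5) 0 := by
    refine copyDet_five hh hW (fun G x => ?_) 0
    have hiff : ∀ e, IsCopy (SimpleGraph.cycleGraph 5) G.graph ![x 0, x 1, x 2, x 3, e] ↔
        (IsWalk G.graph x ∧ x 0 ≠ x 2 ∧ x 1 ≠ x 3 ∧ x 0 ≠ x 3) ∧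
        ((G.graph.Adj (x 0) e ∧ G.graph.Adj e (x 3)) ∧ e ≠ x 1) ∧ e ≠ x 2 := by
      intro e
      rw [isCopy_cycleGraph]
      constructor
      · rintro ⟨hi, ha⟩
        exact ⟨⟨⟨ha 0, ha 1, ha 2⟩, hi.ne (a₁ := 0) (a₂ := 2) (by decide),
          hi.ne (a₁ := 1) (a₂ := 3) (by decide), hi.ne (a₁ := 0) (a₂ := 3) (by decide)⟩,
          ⟨⟨(ha 4).symm, (ha 3).symm⟩, hi.ne (a₁ := 4) (a₂ := 1) (by decide)⟩,
          hi.ne (a₁ := 4) (a₂ := 2) (by decide)⟩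
      · rintro ⟨⟨⟨h1, h2, h3⟩, h4, h5, h6⟩, ⟨⟨h7, h8⟩, h9⟩, h10⟩
        constructor
        · simp [injective_vecCons, injective_vecEmpty, h1.ne, h2.ne, h3.ne, h4, h5, h6, h7.ne,
            h8.ne', h9.symm, h10.symm]
        · intro i
          fin_cases i
          exacts [h1, h2, h3, h8.symm, h7.symm]
    by_cases hx : IsWalk G.graph x ∧ x 0 ≠ x 2 ∧ x 1 ≠ x 3 ∧ x 0 ≠ x 3
    · obtain ⟨⟨h1, h2, h3⟩, h4, h5, h6⟩ := id hx
      rw [if_pos hx]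
      simp only [fun e => (hiff e).trans (and_iff_right hx), commonNbrs, ite_eq_ind]
      rw [sum_ind_ne, sum_ind_ne]
      simp [h1, h3, h2.ne']
    · rw [if_neg hx]
      exact Finset.sum_eq_zero fun e _ => if_neg fun hc => hx ((hiff e).1 hc).1
  intro G H v w hs
  rw [rootedCount_cycleGraph G.graph, rootedCount_cycleGraph H.graph]
  exact h0 G H v w hs

/-- Inclusion and exclusion for two variables that avoid two values. -/
theorem sum_sum_ind_ne {α : Type*} [Fintype α] (P : α → α → Prop) (hP : ∀ e, ¬ P e e) {b c : α}
    (hbc : b ≠ c) :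
    ∑ e, ∑ f, ind (P e f ∧ (e ≠ b ∧ e ≠ c) ∧ f ≠ b ∧ f ≠ c) =
      ∑ e, ∑ f, ind (P e f) - ∑ e, ind (P e b) - ∑ e, ind (P e c) - ∑ f, ind (P b f) -
        ∑ f, ind (P c f) + ind (P c b) + ind (P b c) := by
  classical
  have hinner : ∀ e, ∑ f, ind (P e f ∧ (e ≠ b ∧ e ≠ c) ∧ f ≠ b ∧ f ≠ c) =
      if e ≠ b ∧ e ≠ c then ∑ f, ind (P e f) - ind (P e b) - ind (P e c) else 0 := by
    intro e
    by_cases he : e ≠ b ∧ e ≠ c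
    · have h1 := sum_ind_ne (fun f => P e f ∧ f ≠ b) c
      rw [sum_ind_ne (fun f => P e f) b] at h1
      simp only [ne_eq, hbc.symm, not_false_eq_true, and_true] at h1
      simp only [if_pos he, ← h1]
      simp only [he, true_and, and_assoc, ne_eq, not_false_eq_true]
    · simp only [he, false_and, and_false, ind_false, Finset.sum_const_zero, if_false]
  have hrem : ∀ φ : α → ℚ, (∑ e, if e ≠ b ∧ e ≠ c then φ e else 0) = ∑ e, φ e - φ b - φ c := by
    intro φ
    have : ∀ e, (if e ≠ b ∧ e ≠ c then φ e else 0) =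
        φ e - (if e = b then φ e else 0) - (if e = c then φ e else 0) := by
      intro e
      by_cases h1 : e = b
      · subst h1
        simp [hbc]
      · by_cases h2 : e = c <;> simp [h1, h2, hbc.symm]
    simp only [this, Finset.sum_sub_distrib, Finset.sum_ite_eq', Finset.mem_univ, if_true]
  -- By `hP` the corrections with both variables equal vanish; only the two mixed ones survive.
  simp only [hinner, hrem, Finset.sum_sub_distrib, hP, ind_false]
  ring

-- The cycle is closed by a path `x 0, f, e, x 3` avoiding `x 1` and `x 2`. The four subtracted
-- terms are the cases `f = x 1`, `f = x 2`, `e = x 1`, `e = x 2`; each common neighbour count there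
-- discards `x 0` or `x 3`. The terms added back are the walk itself, hence `+ 1`, and the path `x
-- 0, x 2, x 1, x 3`.
open Classical in
theorem copyDet_cycleGraph_six (hh : 3 ≤ h) (r : Fin 6) :
    CopyDet C h (SimpleGraph.cycleGraph 6) r := by
  have hW : WalkInv (C := C) h fun G x =>
      if IsWalk G.graph x ∧ x 0 ≠ x 2 ∧ x 1 ≠ x 3 ∧ x 0 ≠ x 3 then
      threePaths G (x 0) (x 3) -
      (commonNbrs G (x 1) (x 3) - if G.graph.Adj (x 0) (x 3) then 1 else 0) -
      (if G.graph.Adj (x 0) (x 2) then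
        commonNbrs G (x 2) (x 3) - if G.graph.Adj (x 0) (x 3) then 1 else 0 else 0) -
      (if G.graph.Adj (x 1) (x 3) then
        commonNbrs G (x 0) (x 1) - if G.graph.Adj (x 0) (x 3) then 1 else 0 else 0) -
      (commonNbrs G (x 0) (x 2) - if G.graph.Adj (x 0) (x 3) then 1 else 0) + 1 +
      (if G.graph.Adj (x 0) (x 2) ∧ G.graph.Adj (x 1) (x 3) then 1 else 0) else 0 := by
    refine ⟨fun G H x y hx hy hxy => ?_, fun G x h0 => (ite_ne_right_iff.1 h0).1.1⟩
    simp only [hx, hy, hxy.adj_iff, hxy.eq_iff, ne_eq, pairInv_threePaths hh (hxy 0 3 (by decide)),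
      pairInv_commonNbrs hh (hxy 1 3 (by decide)), pairInv_commonNbrs hh (hxy 2 3 (by decide)),
      pairInv_commonNbrs hh (hxy 0 1 (by decide)), pairInv_commonNbrs hh (hxy 0 2 (by decide))]
  have hext : ∀ (G : ColoredGraph C) (x : Fin 4 → Fin G.n),
      (∑ e, ∑ f, if IsCopy (SimpleGraph.cycleGraph 6) G.graph ![x 0, x 1, x 2, x 3, e, f]
        then (1 : ℚ) else 0) = if IsWalk G.graph x ∧ x 0 ≠ x 2 ∧ x 1 ≠ x 3 ∧ x 0 ≠ x 3 then
      threePaths G (x 0) (x 3) -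
      (commonNbrs G (x 1) (x 3) - if G.graph.Adj (x 0) (x 3) then 1 else 0) -
      (if G.graph.Adj (x 0) (x 2) then
        commonNbrs G (x 2) (x 3) - if G.graph.Adj (x 0) (x 3) then 1 else 0 else 0) -
      (if G.graph.Adj (x 1) (x 3) then
        commonNbrs G (x 0) (x 1) - if G.graph.Adj (x 0) (x 3) then 1 else 0 else 0) -
      (commonNbrs G (x 0) (x 2) - if G.graph.Adj (x 0) (x 3) then 1 else 0) + 1 +
      (if G.graph.Adj (x 0) (x 2) ∧ G.graph.Adj (x 1) (x 3) then 1 else 0) else 0 := by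
    intro G x
    have hiff : ∀ e f, IsCopy (SimpleGraph.cycleGraph 6) G.graph ![x 0, x 1, x 2, x 3, e, f] ↔
        (IsWalk G.graph x ∧ x 0 ≠ x 2 ∧ x 1 ≠ x 3 ∧ x 0 ≠ x 3) ∧
        (G.graph.Adj (x 0) f ∧ G.graph.Adj f e ∧ G.graph.Adj e (x 3) ∧ f ≠ x 3 ∧ x 0 ≠ e) ∧
        (e ≠ x 1 ∧ e ≠ x 2) ∧ f ≠ x 1 ∧ f ≠ x 2 := by
      intro e f
      rw [isCopy_cycleGraph]
      constructor
      · rintro ⟨hi, ha⟩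
        exact ⟨⟨⟨ha 0, ha 1, ha 2⟩, hi.ne (a₁ := 0) (a₂ := 2) (by decide),
          hi.ne (a₁ := 1) (a₂ := 3) (by decide), hi.ne (a₁ := 0) (a₂ := 3) (by decide)⟩,
          ⟨(ha 5).symm, (ha 4).symm, (ha 3).symm, hi.ne (a₁ := 5) (a₂ := 3) (by decide),
            hi.ne (a₁ := 0) (a₂ := 4) (by decide)⟩,
          ⟨hi.ne (a₁ := 4) (a₂ := 1) (by decide), hi.ne (a₁ := 4) (a₂ := 2) (by decide)⟩,
          hi.ne (a₁ := 5) (a₂ := 1) (by decide), hi.ne (a₁ := 5) (a₂ := 2) (by decide)⟩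
      · rintro ⟨⟨⟨h1, h2, h3⟩, h4, h5, h6⟩, ⟨k1, k2, k3, k4, k5⟩, ⟨k6, k7⟩, k8, k9⟩
        constructor
        · simp [injective_vecCons, injective_vecEmpty, h1.ne, h2.ne, h3.ne, h4, h5, h6, k1.ne,
            k2.ne', k3.ne', k4.symm, k5, k6.symm, k7.symm, k8.symm, k9.symm]
        · intro i
          fin_cases i
          exacts [h1, h2, h3, k3.symm, k2.symm, k1.symm]
    by_cases hx : IsWalk G.graph x ∧ x 0 ≠ x 2 ∧ x 1 ≠ x 3 ∧ x 0 ≠ x 3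
    · obtain ⟨⟨h1, h2, h3⟩, h4, h5, h6⟩ := id hx
      have hsecond : ∀ f, ∑ e, ind (G.graph.Adj (x 0) f ∧ G.graph.Adj f e ∧ G.graph.Adj e (x 3) ∧
          f ≠ x 3 ∧ x 0 ≠ e) = if G.graph.Adj (x 0) f ∧ f ≠ x 3 then
            commonNbrs G f (x 3) - ind (G.graph.Adj (x 0) (x 3)) else 0 := by
        intro f
        by_cases hf : G.graph.Adj (x 0) f ∧ f ≠ x 3
        · have := sum_ind_ne (fun e => G.graph.Adj f e ∧ G.graph.Adj e (x 3)) (x 0)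
          simp only [hf.1.symm, true_and] at this
          simp only [if_true, commonNbrs, ite_eq_ind, ← this, hf.1, hf.2, ne_comm (a := x 0),
            true_and, and_assoc, ne_eq, not_false_eq_true]
        · rw [if_neg hf]
          exact Finset.sum_eq_zero fun e _ => if_neg fun hc => hf ⟨hc.1, hc.2.2.2.1⟩
      have hfirst : ∀ e, ∑ f, ind (G.graph.Adj (x 0) f ∧ G.graph.Adj f e ∧ G.graph.Adj e (x 3) ∧
          f ≠ x 3 ∧ x 0 ≠ e) = if G.graph.Adj e (x 3) ∧ x 0 ≠ e then
            commonNbrs G (x 0) e - ind (G.graph.Adj (x 0) (x 3)) else 0 := by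
        intro e
        by_cases he : G.graph.Adj e (x 3) ∧ x 0 ≠ e
        · have := sum_ind_ne (fun f => G.graph.Adj (x 0) f ∧ G.graph.Adj f e) (x 3)
          simp only [he.1.symm, and_true] at this
          simp only [if_true, commonNbrs, ite_eq_ind, ← this, he.1, he.2, true_and, and_true,
            and_assoc, ne_eq, not_false_eq_true]
        · rw [if_neg he]
          exact Finset.sum_eq_zero fun f _ => if_neg fun hc => he ⟨hc.2.2.1, hc.2.2.2.2⟩
      rw [if_pos hx]
      simp only [fun e f => (hiff e f).trans (and_iff_right hx), threePaths, ite_eq_ind]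
      rw [sum_sum_ind_ne (fun e f => G.graph.Adj (x 0) f ∧ G.graph.Adj f e ∧ G.graph.Adj e (x 3) ∧
        f ≠ x 3 ∧ x 0 ≠ e) (fun e hc => hc.2.1.ne rfl) h2.ne, hsecond, hsecond, hfirst, hfirst]
      simp only [h1, h2, h2.symm, h3, h4, h5, h1.ne, h3.ne, ne_eq, not_false_eq_true, and_true,
        true_and, if_true, ind_true]
    · rw [if_neg hx]
      exact Finset.sum_eq_zero fun e _ => Finset.sum_eq_zero fun f _ =>
        if_neg fun hc => hx ((hiff e f).1 hc).1
  have key : ∀ (G : ColoredGraph C) (v : Fin G.n),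
      rootedCount (IsCopy (SimpleGraph.cycleGraph 6) G.graph) 0 v =
        ∑ x : Fin 4 → Fin G.n, if x 0 = v then ∑ e, ∑ f,
          if IsCopy (SimpleGraph.cycleGraph 6) G.graph ![x 0, x 1, x 2, x 3, e, f]
            then (1 : ℚ) else 0 else 0 := by
    intro G v
    rw [rootedCount, sum_fin_six]
    refine Finset.sum_congr rfl fun x _ => ?_
    by_cases hx : x 0 = v <;> simp [hx]
  intro G H v w hs
  rw [rootedCount_cycleGraph G.graph, rootedCount_cycleGraph H.graph, key, key]
  simp only [hext]
  exact hW.sum_eq hh hs 0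

end Cycles

end N2FWL

theorem mainTheorem6 :
    ∃ h₀ : ℕ, ∀ h : ℕ, h₀ ≤ h → ∀ C : Type*,
      (∀ k : ℕ, 3 ≤ k → k ≤ 6 →
        N2FWL.CanCount C h (N2FWL.copiesThrough (SimpleGraph.cycleGraph k))) ∧
      (∀ F : SimpleGraph (Fin 4), F.Connected →
        N2FWL.CanCount C h (N2FWL.inducedThrough F) ∧
        N2FWL.CanCount C h (N2FWL.copiesThrough F) ∧
        ∀ r : Fin 4, N2FWL.CanCount C h (N2FWL.inducedAt F r) ∧
          N2FWL.CanCount C h (N2FWL.copiesAt F r)) ∧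
      (N2FWL.CanCount C h (N2FWL.copiesAt (SimpleGraph.pathGraph 5) 0) ∧
        N2FWL.CanCount C h (N2FWL.copiesThrough (SimpleGraph.pathGraph 5))) := by
  -- Three hops span a walk on four nodes.
  refine ⟨3, fun h hh C => ⟨fun k hk3 hk6 => ?_, fun F hF => ?_, ?_, ?_⟩⟩
  · apply N2FWL.canCount_copiesThrough
    interval_cases k
    · exact N2FWL.copyDet_cycleGraph_three hh
    -- The 4-cycle is one of the connected graphs on four vertices.
    · exact fun r => (N2FWL.copyDet_indDet hh SimpleGraph.cycleGraph_connected r).1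
    · exact N2FWL.copyDet_cycleGraph_five hh
    · exact N2FWL.copyDet_cycleGraph_six hh
  · exact ⟨N2FWL.canCount_inducedThrough fun r => (N2FWL.copyDet_indDet hh hF r).2,
      N2FWL.canCount_copiesThrough fun r => (N2FWL.copyDet_indDet hh hF r).1,
      fun r => ⟨(N2FWL.copyDet_indDet hh hF r).2.canCount_at,
        (N2FWL.copyDet_indDet hh hF r).1.canCount_at⟩⟩
  · exact (N2FWL.copyDet_pathGraph_five hh 0).canCount_at
  · exact N2FWL.canCount_copiesThrough (N2FWL.copyDet_pathGraph_five hh)
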